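/- Let $n,d\ge 0$, let $\mathbf P(n)=\mathbb F_2[x_1,\dots,x_n]$ and let $\mathbf P^d(n)$ be its subspace of homogeneous polynomials of degree $d$. The Steenrod squares $\mathrm{Sq}^k$ ($k\ge 0$) are the linear operators on $\mathbf P(n)$ determined by $\mathrm{Sq}^0=\mathrm{id}$, $\mathrm{Sq}^1(x_i)=x_i^2$, $\mathrm{Sq}^k(x_i)=0$ for $k>1$, $\mathrm{Sq}^k(1)=0$ for $k>0$ and the Cartan formula $\mathrm{Sq}^k(fg)=\sum_{i=0}^k\mathrm{Sq}^i(f)\,\mathrm{Sq}^{k-i}(g)$. A polynomial is hit if it is a finite sum $\sum_{k>0}\mathrm{Sq}^k(g_k)$, and $\mathbf Q^d(n)$ (the cohits) is the quotient of $\mathbf P^d(n)$ by the hit polynomials in it. The block of a monomial $x_1^{d_1}\cdots x_n^{d_n}$ is the $(0,1)$-array $F$ with $n$ rows whose $i$-th row is the reversed binary expansion of $d_i$ (continued by zeros). Its $\omega$-vector $\omega(F)=(\omega_1,\omega_2,\dots)$ is the vector of column sums, and it is descending if $\omega_j\ge\omega_{j+1}$ for all $j\ge 1$. The block $F$ is semistandard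 if for each $1\le r\le n$ the array $F[r]$ of its first $r$ rows has a descending $\omega$-vector. The column-position array $\mathrm{cp}(F)$ has as its $j$-th column the list, in increasing order, of the positions (in $\{1,\dots,n\}$) of the rows of $F$ with a digit $1$ in column $j$, followed by zeros. The degree $d$ is row-regular for $n$ if $d=\sum_{i=1}^n(2^{\lambda_i}-1)$ for some integers $\lambda_1>\cdots>\lambda_n\ge 0$. Theorem. (a) If $d$ is row-regular for $n$, then there is exactly one descending vector that is the $\omega$-vector of a monomial in $\mathbf P^d(n)$. (b) Suppose that exactly one descending vector $\omega$ is the $\omega$-vector of a monomial in $\mathbf P^d(n)$. Then $\mathbf Q^d(n)$ is spanned over $\mathbb F_2$ by the classes of the monomials of degree $d$ whose blocks are semistandard. Moreover, if $\mu$ is the Ferrers diagram whose $j$-th column has length $\omega_j$, then $F\mapsto\mathrm{cp}(F)$ is a bijection from the semistandard blocks of degree $d$ to the (finitely many) semistandard Young tableaux of shape $\mu$ with entries in $\{1,\dots,n\}$, so that $\dim_{\mathbb F_2}\mathbf Q^d(n)$ is at most the number of these tableaux. -/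

import Mathlib

namespace HitProblem

/-- The polynomial algebra `F₂[x₁, …, xₙ]`; the variable `x_{i+1}` is `X i` for `i : Fin n`. -/
abbrev P (n : ℕ) : Type := MvPolynomial (Fin n) (ZMod 2)

/-- The homogeneous polynomials of degree `d`. -/
abbrev homog (n d : ℕ) : Submodule (ZMod 2) (P n) :=
  MvPolynomial.homogeneousSubmodule (Fin n) (ZMod 2) d

/-- The total Steenrod square `SQ = ∑ₖ Sqᵏ tᵏ`, with a variable `t` that records the grading:
the algebra homomorphism with `SQ(xᵢ) = xᵢ + xᵢ² t`. -/
noncomputable def totalSq (n : ℕ) : P n →ₐ[ZMod 2] Polynomial (P n) :=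
  MvPolynomial.aeval fun i =>
    Polynomial.C (MvPolynomial.X i) + Polynomial.C (MvPolynomial.X i ^ 2) * Polynomial.X

/-- The Steenrod square `Sqᵏ` on polynomials: the coefficient of `tᵏ` in the total square. -/
noncomputable def Sq (n k : ℕ) : P n →ₗ[ZMod 2] P n :=
  ((Polynomial.lcoeff (P n) k).restrictScalars (ZMod 2)).comp (totalSq n).toLinearMap

/-- `Sq⁰` is the identity. -/
theorem Sq_zero (n : ℕ) (f : P n) : Sq n 0 f = f := by
  have h : ((Polynomial.aeval (0 : P n)).restrictScalars (ZMod 2)).comp (totalSq n)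
      = AlgHom.id (ZMod 2) (P n) := by
    ext i
    simp [totalSq]
  have := DFunLike.congr_fun h f
  simpa [Sq, Polynomial.coeff_zero_eq_aeval_zero] using this

/-- `Sq¹ xᵢ = xᵢ²`. -/
theorem Sq_one_X (n : ℕ) (i : Fin n) :
    Sq n 1 (MvPolynomial.X i) = MvPolynomial.X i ^ 2 := by
  simp [Sq, totalSq, Polynomial.coeff_C, -map_pow]

/-- `Sqᵏ xᵢ = 0` for `k > 1`. -/
theorem Sq_X (n k : ℕ) (hk : 1 < k) (i : Fin n) :
    Sq n k (MvPolynomial.X i) = 0 := by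
  have h1 : k ≠ 0 := by omega
  have h2 : (1 : ℕ) ≠ k := by omega
  simp [Sq, totalSq, Polynomial.coeff_C, Polynomial.coeff_X, h1, h2, -map_pow]

/-- The Cartan formula. -/
theorem Sq_mul (n k : ℕ) (f g : P n) :
    Sq n k (f * g) = ∑ p ∈ Finset.HasAntidiagonal.antidiagonal k, Sq n p.1 f * Sq n p.2 g := by
  simp [Sq, Polynomial.coeff_mul]

/-- The hit polynomials: finite sums `∑_{k>0} Sqᵏ(gₖ)`. -/
noncomputable def hits (n : ℕ) : Submodule (ZMod 2) (P n) :=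
  Submodule.span (ZMod 2) {h | ∃ k : ℕ, 0 < k ∧ ∃ g : P n, h = Sq n k g}

/-- The cohits `Q^d(n)`: the quotient of the polynomials of degree `d` by the hit ones. -/
abbrev Cohits (n d : ℕ) : Type := homog n d ⧸ (hits n).submoduleOf (homog n d)

/-- The class in `Q^d(n)` of the monomial of degree `d` with exponent vector `e`. -/
noncomputable def monomialClass {n d : ℕ} (e : Fin n →₀ ℕ) (he : e.degree = d) : Cohits n d :=
  Submodule.Quotient.mk
    ⟨MvPolynomial.monomial e 1, MvPolynomial.isHomogeneous_monomial 1 he⟩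

/-- `(0,1)`-arrays with `n` rows; columns are indexed from `0` and the array is continued to the
right (by zeros, for the block of a monomial). -/
abbrev BinArray (n : ℕ) : Type := Fin n → ℕ → Bool

/-- The block of a monomial: row `i` is the reversed binary expansion of the `i`-th exponent. -/
def block {n : ℕ} (e : Fin n →₀ ℕ) : BinArray n := fun i j => (e i).testBit j

/-- The rows occupied by a digit `1` in column `j`. -/
def column {n : ℕ} (F : BinArray n) (j : ℕ) : Finset (Fin n) :=
  Finset.univ.filter fun i => F i j = true

/-- The `ω`-vector: the vector of column sums. -/
def omega {n : ℕ} (F : BinArray n) : ℕ → ℕ := fun j => (column F j).card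

/-- The array `F[r]` formed by the first `r` rows of `F`. -/
def firstRows {n : ℕ} (F : BinArray n) (r : ℕ) (hr : r ≤ n) : BinArray r :=
  fun i j => F (Fin.castLE hr i) j

/-- A block is semistandard if `ω(F[r])` is descending for `1 ≤ r ≤ n`. -/
def IsSemistandard {n : ℕ} (F : BinArray n) : Prop :=
  ∀ (r : ℕ) (hr : r ≤ n), 1 ≤ r → Antitone (omega (firstRows F r hr))

/-- `w` is a descending `ω`-vector of (a monomial in) `P^d(n)`. -/
def IsDescendingOmega (n d : ℕ) (w : ℕ → ℕ) : Prop :=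
  Antitone w ∧ ∃ e : Fin n →₀ ℕ, e.degree = d ∧ omega (block e) = w

/-- `d` is row-regular for `n`: `d = ∑ (2^{lam i} - 1)` over `n` strictly decreasing
nonnegative integers `lam i`. -/
def IsRowRegular (n d : ℕ) : Prop :=
  ∃ lam : Fin n → ℕ, StrictAnti lam ∧ d = ∑ i, (2 ^ lam i - 1)

/-- The column-position array of `F`: column `j` lists in increasing order the positions, counted
from `1`, of the rows with a digit `1` in column `j` of `F`, followed by zeros. -/
def cp {n : ℕ} (F : BinArray n) : ℕ → ℕ → ℕ := fun i j =>
  (((column F j).sort (· ≤ ·)).map fun r => (r : ℕ) + 1).getD i 0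

/-- The semistandard Young tableaux of shape `μ` with entries in `{1, …, n}`. -/
abbrev Tableaux (n : ℕ) (μ : YoungDiagram) : Type :=
  {T : SemistandardYoungTableau μ // ∀ i j : ℕ, (i, j) ∈ μ → 1 ≤ T i j ∧ T i j ≤ n}

end HitProblem

namespace HitProblem

open Finset

/-! ### Binomial coefficients modulo two -/

/-! By Lucas's theorem (`Sq_mono`) a square adds to each exponent of a monomial a number whose
binary digits are among those of the exponent. It thus erases digits in some column and carries them
to the right, which makes induction over ω-vectors possible. Columns are numbered from 0.

Part (a). Conjugating partitions, the descending ω-vectors of degree d correspond to the multisets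
of n numbers a with ∑ (2^a - 1) = d, that is, ∑ 2^a = d + n. If n distinct numbers do this, they
give the binary expansion of d + n, and no other n powers of two have that sum
(`card_le_of_sum_two_pow_eq`).

Part (b). Let w be the unique descending vector. Suppose first that ω(e) is smaller than w, compared
from the left, with first difference in column k. By uniqueness the columns up to k have no
descending completion of degree d. This numerical obstruction becomes a hit equation by moving
squares from one factor to another (`mono_indicator_mul_sq_mem`), up to monomials still smaller from
the left, so by induction `mono e` is hit (`mono_mem_hitsIn_of_lex_lt`).

If ω(e) is larger than w, the first differing column is longer than the one before it
(`exists_lt_of_gt_descending`); if ω(e) = w and the block is not semistandard, such an ascent occurs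
within its first ρ rows. In both cases a combination of squares exchanges digits between the two
columns (`mono_mem_negligible`) and rewrites `mono e`, modulo hits, by monomials that are larger
from the right: a smaller left part is already hit, and every other error term carries past both
columns or moves digits to the right in late rows. There are finitely many monomials of degree d, so
the rewriting ends at semistandard blocks.

For tableaux, an entry of `cp` is at most r exactly when enough digits of its column lie in the
first r rows (`cp_le_iff`). Weakly increasing rows therefore mean the same as descending ω-vectors
of all F[r], and the columns of a tableau recover the block. -/

theorem choose_mod_two_eq_one_iff (m t : ℕ) :
    m.choose t % 2 = 1 ↔ ∀ j, t.testBit j = true → m.testBit j = true := by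
  induction m using Nat.strong_induction_on generalizing t with
  | _ m ih =>
    rcases Nat.eq_zero_or_pos m with rfl | hm
    · rcases Nat.eq_zero_or_pos t with rfl | ht
      · simp
      · obtain ⟨j, hj⟩ := Nat.exists_testBit_of_ne_zero ht.ne'
        rw [Nat.choose_eq_zero_of_lt ht]
        simp only [Nat.zero_mod, zero_ne_one, Nat.zero_testBit, Bool.false_eq_true, imp_false,
          false_iff]
        exact fun h => h j hj
    -- Lucas's congruence splits off the lowest digit; induction treats the halves.
    · have hl : m.choose t % 2 = ((m % 2).choose (t % 2) * (m / 2).choose (t / 2)) % 2 :=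
        haveI : Fact (Nat.Prime 2) := ⟨Nat.prime_two⟩
        Choose.choose_modEq_choose_mod_mul_choose_div_nat (p := 2) (n := m) (k := t)
      have h2 := ih (m / 2) (by omega) (t / 2)
      have hbit : (∀ j, t.testBit j = true → m.testBit j = true) ↔
          (t.testBit 0 = true → m.testBit 0 = true) ∧
            ∀ j, (t / 2).testBit j = true → (m / 2).testBit j = true := by
        constructor
        · intro h
          refine ⟨h 0, fun j => ?_⟩
          simpa [Nat.testBit_succ] using h (j + 1)
        · rintro ⟨h0, h1⟩ (_ | j)
          · exact h0
          · simpa [Nat.testBit_succ] using h1 j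
      rw [hbit, ← h2, hl, Nat.testBit_zero, Nat.testBit_zero]
      rcases Nat.mod_two_eq_zero_or_one m with hm2 | hm2 <;>
      rcases Nat.mod_two_eq_zero_or_one t with ht2 | ht2 <;>
      simp [hm2, ht2]

theorem le_of_testBit_imp {t m : ℕ} (h : ∀ j, t.testBit j = true → m.testBit j = true) :
    t ≤ m := by
  by_contra hlt
  have h1 := (choose_mod_two_eq_one_iff m t).2 h
  rw [Nat.choose_eq_zero_of_lt (not_le.1 hlt)] at h1
  simp at h1

/-! ### Steenrod squares of monomials -/

variable {n : ℕ}

/-- The monomial with exponents `e`. -/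
noncomputable def mono (e : Fin n → ℕ) : P n := ∏ i, MvPolynomial.X i ^ e i

theorem mono_add (e f : Fin n → ℕ) : mono (e + f) = mono e * mono f := by
  simp [mono, pow_add, prod_mul_distrib]

theorem mono_mul_nat (k : ℕ) (e : Fin n → ℕ) : mono (fun i => k * e i) = mono e ^ k := by
  simp [mono, ← prod_pow, ← pow_mul, mul_comm]

theorem monomial_eq_mono (e : Fin n →₀ ℕ) : MvPolynomial.monomial e (1 : ZMod 2) = mono e := by
  rw [MvPolynomial.monomial_eq, mono, Finsupp.prod_fintype _ _ (by simp)]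
  simp

/-- The exponents that `Sq K` adds to those of `mono e`. -/
noncomputable def sqTerms (e : Fin n → ℕ) (K : ℕ) : Finset (Fin n → ℕ) := by
  classical
  exact (Fintype.piFinset fun i => range (e i + 1)).filter fun t =>
    ∑ i, t i = K ∧ ∀ i j, (t i).testBit j = true → (e i).testBit j = true

theorem mem_sqTerms {e t : Fin n → ℕ} {K : ℕ} :
    t ∈ sqTerms e K ↔ ∑ i, t i = K ∧ ∀ i j, (t i).testBit j = true → (e i).testBit j = true := by
  classical
  simp only [sqTerms, mem_filter, Fintype.mem_piFinset, mem_range, and_iff_right_iff_imp, and_imp]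
  exact fun _ h i => Nat.lt_succ_of_le (le_of_testBit_imp (h i))

theorem natCast_eq_ite (N : ℕ) : (N : P n) = if N % 2 = 1 then 1 else 0 := by
  have : CharP (P n) 2 := inferInstance
  rw [← Nat.mod_add_div N 2]
  have h2 : ((2 : ℕ) : P n) = 0 := CharP.cast_eq_zero _ 2
  rcases Nat.mod_two_eq_zero_or_one N with h | h <;> rw [h] <;> push_cast <;> push_cast at h2 <;>
    simp [h2, Nat.add_mod]

theorem totalSq_X_pow (i : Fin n) (m : ℕ) :
    totalSq n (MvPolynomial.X i ^ m) =
      ∑ t ∈ range (m + 1),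
        Polynomial.C ((m.choose t : P n) * MvPolynomial.X i ^ (m + t)) * Polynomial.X ^ t := by
  rw [map_pow, totalSq, MvPolynomial.aeval_X, add_comm, add_pow]
  refine sum_congr rfl fun t ht => ?_
  have hle : t ≤ m := Nat.lt_succ_iff.1 (mem_range.1 ht)
  obtain ⟨s, rfl⟩ := Nat.exists_eq_add_of_le hle
  simp only [Nat.add_sub_cancel_left, mul_pow, map_mul, map_pow, map_natCast]
  ring

/-- Expanding each (x + x² t)^m binomially gives products of binomial coefficients, which are odd
exactly under the containment of digits. -/
theorem Sq_mono (K : ℕ) (e : Fin n → ℕ) :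
    Sq n K (mono e) = ∑ t ∈ sqTerms e K, mono (e + t) := by
  classical
  have h1 : totalSq n (mono e) = ∑ t ∈ Fintype.piFinset fun i => range (e i + 1),
      Polynomial.C (((∏ i, (e i).choose (t i) : ℕ) : P n) * mono (e + t)) *
        Polynomial.X ^ (∑ i, t i) := by
    rw [mono, map_prod]
    simp_rw [totalSq_X_pow]
    rw [prod_univ_sum]
    refine sum_congr rfl fun t _ => ?_
    rw [prod_mul_distrib, prod_pow_eq_pow_sum, ← map_prod, prod_mul_distrib, mono]
    push_cast
    rfl
  have h2 : Sq n K (mono e) = (totalSq n (mono e)).coeff K := rfl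
  rw [h2, h1, Polynomial.finsetSum_coeff, sqTerms, sum_filter]
  refine sum_congr rfl fun t _ => ?_
  rw [Polynomial.coeff_C_mul_X_pow]
  by_cases hK : ∑ i, t i = K
  · simp only [hK, if_true, true_and]
    rw [natCast_eq_ite]
    have : (∏ i, (e i).choose (t i)) % 2 = 1 ↔
        ∀ i j, (t i).testBit j = true → (e i).testBit j = true := by
      rw [← Nat.two_dvd_ne_zero, Nat.prime_two.prime.dvd_finsetProd_iff]
      simp [choose_mod_two_eq_one_iff]
    simp [this]
  · simp [hK, Ne.symm hK]

theorem Sq_mono_self (e : Fin n → ℕ) : Sq n (∑ i, e i) (mono e) = mono e ^ 2 := by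
  have : sqTerms e (∑ i, e i) = {e} := by
    ext t
    rw [mem_sqTerms, mem_singleton]
    constructor
    · rintro ⟨h1, h2⟩
      have hle : ∀ i ∈ (univ : Finset (Fin n)), t i ≤ e i := fun i _ => le_of_testBit_imp (h2 i)
      funext i
      exact (sum_eq_sum_iff_of_le hle).1 h1 i (mem_univ i)
    · rintro rfl
      simp
  rw [Sq_mono, this, sum_singleton, mono_add, sq]

/-- The total square is a ring homomorphism, and in characteristic 2 the Frobenius raises both the
coefficients and the variable t to the power 2^k. -/
theorem Sq_pow_two_pow (k K : ℕ) (g : P n) :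
    Sq n K (g ^ 2 ^ k) = if 2 ^ k ∣ K then Sq n (K / 2 ^ k) g ^ 2 ^ k else 0 := by
  have h : Sq n K (g ^ 2 ^ k) = ((totalSq n g) ^ 2 ^ k).coeff K := by
    rw [← map_pow]; rfl
  rw [h, ← Polynomial.map_iterateFrobenius_expand 2, Polynomial.coeff_map,
    Polynomial.coeff_expand (by positivity)]
  split_ifs
  · rw [iterateFrobenius_def]; rfl
  · simp

/-- The span of the hit polynomials `Sq K (mono g)` of degree `D`. -/
noncomputable def hitsIn (n D : ℕ) : Submodule (ZMod 2) (P n) :=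
  Submodule.span (ZMod 2)
    {h | ∃ (K : ℕ) (g : Fin n → ℕ), 0 < K ∧ ∑ i, g i + K = D ∧ h = Sq n K (mono g)}

theorem hitsIn_le_hits (D : ℕ) : hitsIn n D ≤ hits n := by
  refine Submodule.span_mono ?_
  rintro h ⟨K, g, hK, -, rfl⟩
  exact ⟨K, hK, _, rfl⟩

theorem Sq_mono_mem_hitsIn {K D : ℕ} {g : Fin n → ℕ} (hK : 0 < K) (hD : ∑ i, g i + K = D) :
    Sq n K (mono g) ∈ hitsIn n D :=
  Submodule.subset_span ⟨K, g, hK, hD, rfl⟩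

/-! ### Products of two-powers of distinct variables -/

/-- The exponents `2 ^ a i` on the variables in `A`. -/
def twoPows (A : Finset (Fin n)) (a : Fin n → ℕ) : Fin n → ℕ :=
  fun i => if i ∈ A then 2 ^ a i else 0

/-- An exponent with a single binary digit can only stay or double. -/
theorem exists_twoPows_of_mem_sqTerms {A : Finset (Fin n)} {a t : Fin n → ℕ} {K : ℕ}
    (ht : t ∈ sqTerms (twoPows A a) K) :
    ∃ a', twoPows A a + t = twoPows A a' := by
  rw [mem_sqTerms] at ht
  refine ⟨fun i => if t i = 0 then a i else a i + 1, funext fun i => ?_⟩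
  have hi := ht.2 i
  by_cases hA : i ∈ A
  · by_cases h0 : t i = 0
    · simp [twoPows, hA, h0]
    · simp only [twoPows, hA, if_true] at hi
      have : t i = 2 ^ a i := by
        obtain ⟨j, hj⟩ := Nat.exists_testBit_of_ne_zero h0
        have hja : a i = j := by simpa [Nat.testBit_two_pow] using hi j hj
        refine Nat.eq_of_testBit_eq fun l => ?_
        rw [Nat.testBit_two_pow]
        by_cases hl : a i = l
        · subst hl; simp [hja, hj]
        · simp only [hl, decide_false]
          by_contra hne
          have := hi l (by simpa using hne)
          simp [hl] at this
      simp [twoPows, hA, this, pow_succ, mul_two]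
  · have h0 : t i = 0 := by
      refine Nat.zero_of_testBit_eq_false fun j => ?_
      by_contra hne
      have := hi j (by simpa using hne)
      simp [twoPows, hA] at this
    simp [twoPows, hA, h0]

/-- By the Cartan formula, f · Sq^K h is Sq^K (f h) minus terms Sq^j f · Sq^l h with j > 0 and l <
K. Since Sq^j f is again a sum of products of two-powers, induction on K moves the whole square from
h to f. -/
theorem mono_twoPows_mul_Sq_mem (A : Finset (Fin n)) (h : Fin n → ℕ) (K : ℕ) (a : Fin n → ℕ) :
    mono (twoPows A a) * Sq n K (mono h) ∈
      hitsIn n (∑ i, twoPows A a i + ∑ i, h i + K) ⊔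
        Submodule.span (ZMod 2) {q | ∃ a' : Fin n → ℕ,
          ∑ i, twoPows A a' i = ∑ i, twoPows A a i + K ∧ q = mono (twoPows A a') * mono h} := by
  induction K using Nat.strong_induction_on generalizing a with
  | _ K ih =>
    rcases Nat.eq_zero_or_pos K with rfl | hK
    · rw [Sq_zero]
      exact Submodule.mem_sup_right (Submodule.subset_span ⟨a, rfl, rfl⟩)
    · have hmem : ((0, K) : ℕ × ℕ) ∈ antidiagonal K := by simp
      have hc := Sq_mul n K (mono (twoPows A a)) (mono h)
      rw [← mono_add, ← add_sum_erase _ _ hmem, Sq_zero] at hc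
      rw [eq_comm, ← eq_sub_iff_add_eq] at hc
      rw [hc]
      refine Submodule.sub_mem _ (Submodule.mem_sup_left (Sq_mono_mem_hitsIn hK ?_))
        (Submodule.sum_mem _ fun p hp => ?_)
      · simp [sum_add_distrib]
      · obtain ⟨hne, hp⟩ := mem_erase.1 hp
        rw [HasAntidiagonal.mem_antidiagonal] at hp
        obtain ⟨j, l⟩ := p
        simp only at hp ⊢
        have hj : 0 < j := by
          rcases Nat.eq_zero_or_pos j with rfl | hj
          · exact absurd (by simp at hp; simp [hp]) hne
          · exact hj
        rw [Sq_mono, sum_mul]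
        refine Submodule.sum_mem _ fun t ht => ?_
        obtain ⟨a', ha'⟩ := exists_twoPows_of_mem_sqTerms ht
        have hs : ∑ i, twoPows A a' i = ∑ i, twoPows A a i + j := by
          rw [← ha', ← (mem_sqTerms.1 ht).1, ← sum_add_distrib]; rfl
        have := ih l (by omega) a'
        rw [ha']
        rw [hs] at this
        have e1 : ∑ i, twoPows A a i + j + ∑ i, h i + l = ∑ i, twoPows A a i + ∑ i, h i + K := by
          omega
        have e2 : ∑ i, twoPows A a i + j + l = ∑ i, twoPows A a i + K := by omega
        rwa [e1, e2] at this

/-- The square of h is its top Steenrod square. Moving that square onto the variables of A would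
leave products of two-powers of total degree #A + deg h, and by hypothesis there are none. -/
theorem mono_indicator_mul_sq_mem (A : Finset (Fin n)) (h : Fin n → ℕ)
    (hno : ¬ ∃ a : Fin n → ℕ, ∑ i ∈ A, 2 ^ a i = #A + ∑ i, h i) :
    mono (fun i => if i ∈ A then 1 else 0) * mono h ^ 2 ∈ hitsIn n (#A + 2 * ∑ i, h i) := by
  have hsum : ∀ a : Fin n → ℕ, ∑ i, twoPows A a i = ∑ i ∈ A, 2 ^ a i := fun a => by
    simp [twoPows]
  have key := mono_twoPows_mul_Sq_mem A h (∑ i, h i) 0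
  have h0 : twoPows A (0 : Fin n → ℕ) = fun i => if i ∈ A then 1 else 0 := by
    funext i; simp [twoPows]
  have hempty : {q | ∃ a' : Fin n → ℕ, ∑ i, twoPows A a' i =
      ∑ i, twoPows A 0 i + ∑ i, h i ∧ q = mono (twoPows A a') * mono h} = ∅ := by
    rw [Set.eq_empty_iff_forall_notMem]
    rintro q ⟨a', ha', -⟩
    refine hno ⟨a', ?_⟩
    rw [hsum, hsum] at ha'
    simpa using ha'
  rw [hempty, Submodule.span_empty, sup_bot_eq, Sq_mono_self, h0] at key
  convert key using 2
  simp
  ring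

/-! ### The effect of squares on the left columns -/

/-- The array whose rows are the reversed binary expansions of the entries of `e`. -/
def bits (e : Fin n → ℕ) : BinArray n := fun i j => (e i).testBit j

theorem mem_column {F : BinArray n} {i : Fin n} {j : ℕ} : i ∈ column F j ↔ F i j = true :=
  mem_filter.trans (and_iff_right (mem_univ _))

theorem mem_column_bits {e : Fin n → ℕ} {i : Fin n} {j : ℕ} :
    i ∈ column (bits e) j ↔ (e i).testBit j = true :=
  mem_column

theorem testBit_add_mul_of_lt {c j : ℕ} (hj : j < c) (x u : ℕ) :
    (x + 2 ^ c * u).testBit j = x.testBit j := by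
  have h1 := Nat.testBit_mod_two_pow (x + 2 ^ c * u) c j
  have h2 := Nat.testBit_mod_two_pow x c j
  rw [Nat.add_mul_mod_self_left] at h1
  simpa [hj] using h1.symm.trans h2

theorem testBit_add_mul_self (c x u : ℕ) :
    (x + 2 ^ c * u).testBit c = (x.testBit c ^^ u.testBit 0) := by
  simp only [Nat.testBit_eq_decide_div_mod_eq]
  rw [Nat.add_mul_div_left _ _ (by positivity), pow_zero, Nat.div_one]
  rcases Nat.mod_two_eq_zero_or_one (x / 2 ^ c) with h | h <;>
  rcases Nat.mod_two_eq_zero_or_one u with h' | h' <;> simp [Nat.add_mod, h, h']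

theorem two_pow_dvd_of_testBit {c x : ℕ} (h : ∀ j < c, x.testBit j = false) : 2 ^ c ∣ x := by
  refine Nat.dvd_of_mod_eq_zero (Nat.zero_of_testBit_eq_false fun j => ?_)
  rw [Nat.testBit_mod_two_pow]
  by_cases hj : j < c <;> simp [hj, h]

/-- `w` is smaller than `v` at the first column where they differ, and this is before `k`. -/
def LowerBefore (k : ℕ) (w v : ℕ → ℕ) : Prop :=
  ∃ c < k, (∀ j < c, w j = v j) ∧ w c < v c

/-- In the first column c where some t i has a digit, each such digit meets a digit of e and
cancels, carrying to the right; all columns before c are untouched. -/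
theorem lowerBefore_add {k : ℕ} {e t : Fin n → ℕ} (h : Fin n → ℕ)
    (hsub : ∀ i j, (t i).testBit j = true → (e i).testBit j = true)
    (hne : ∃ i, ¬ 2 ^ k ∣ t i) :
    LowerBefore k (omega (bits fun i => e i + t i + 2 ^ k * h i)) (omega (bits e)) := by
  classical
  obtain ⟨i₀, hi₀⟩ := hne
  have hex : ∃ c, c < k ∧ ∃ i, (t i).testBit c = true := by
    by_contra hno
    push Not at hno
    exact hi₀ (two_pow_dvd_of_testBit fun j hj => by simpa using hno j hj i₀)
  set c := Nat.find hex
  obtain ⟨hck, i₁, hi₁⟩ := Nat.find_spec hex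
  have hdvd : ∀ i, 2 ^ c ∣ t i := fun i => two_pow_dvd_of_testBit fun j hj => by
    by_contra hb
    exact Nat.find_min hex hj ⟨hj.trans hck, i, by simpa using hb⟩
  choose s hs using hdvd
  obtain ⟨m, hm⟩ := Nat.exists_eq_add_of_lt hck
  have hform : ∀ i, e i + t i + 2 ^ k * h i = e i + 2 ^ c * (s i + 2 ^ (m + 1) * h i) := by
    intro i
    rw [hs i, hm, add_assoc c m 1, pow_add]
    ring
  have hs0 : ∀ i, (s i + 2 ^ (m + 1) * h i).testBit 0 = (t i).testBit c := by
    intro i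
    rw [testBit_add_mul_of_lt (Nat.succ_pos m), hs i, Nat.testBit_two_pow_mul]
    simp
  refine ⟨c, hck, fun j hj => ?_, ?_⟩
  · unfold omega
    congr 1
    ext i
    rw [mem_column_bits, mem_column_bits, hform, testBit_add_mul_of_lt hj]
  · refine card_lt_card ((ssubset_iff_of_subset fun i hi => ?_).2 ⟨i₁, ?_, ?_⟩)
    · rw [mem_column_bits] at hi ⊢
      rw [hform, testBit_add_mul_self, hs0] at hi
      by_cases ht : (t i).testBit c = true
      · exact hsub i c ht
      · simpa [ht] using hi
    · rw [mem_column_bits]; exact hsub _ _ hi₁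
    · rw [mem_column_bits, hform, testBit_add_mul_self, hs0]
      have h1 : (t i₁).testBit c = true := hi₁
      simp [h1, hsub _ _ h1]

/-- The span of the monomials of degree `d` whose exponents satisfy `p`. -/
noncomputable def monoSpan (d : ℕ) (p : (Fin n → ℕ) → Prop) : Submodule (ZMod 2) (P n) :=
  Submodule.span (ZMod 2) {q | ∃ e : Fin n → ℕ, ∑ i, e i = d ∧ p e ∧ q = mono e}

theorem mono_mem_monoSpan {d : ℕ} {p : (Fin n → ℕ) → Prop} {e : Fin n → ℕ}
    (hd : ∑ i, e i = d) (hp : p e) : mono e ∈ monoSpan d p :=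
  Submodule.subset_span ⟨e, hd, hp, rfl⟩

/-- A hit equation for b, raised to the power 2^k, becomes one for Sq^(2^k K). In the Cartan formula
the other terms apply a square of positive degree to `mono l`, which lowers a column before k. -/
theorem mono_mul_pow_mem {k D : ℕ} {l : Fin n → ℕ} (hl : ∀ i, l i < 2 ^ k) {b : P n}
    (hb : b ∈ hitsIn n D) :
    mono l * b ^ 2 ^ k ∈ hitsIn n (∑ i, l i + 2 ^ k * D) ⊔
      monoSpan (∑ i, l i + 2 ^ k * D) fun e =>
        LowerBefore k (omega (bits e)) (omega (bits l)) := by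
  induction hb using Submodule.span_induction with
  | zero => simp
  | add x y _ _ hx hy =>
    rw [add_pow_char_pow x y 2 k, mul_add]
    exact Submodule.add_mem _ hx hy
  | smul r x _ hx =>
    rw [smul_pow, mul_smul_comm]
    exact Submodule.smul_mem _ _ hx
  | mem x hx =>
    obtain ⟨K, g, hK, hD, rfl⟩ := hx
    have hmem : ((0, 2 ^ k * K) : ℕ × ℕ) ∈ antidiagonal (2 ^ k * K) := by simp
    have hpos : 0 < 2 ^ k := by positivity
    have hc := Sq_mul n (2 ^ k * K) (mono l) (mono g ^ 2 ^ k)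
    rw [← mono_mul_nat, ← mono_add, ← add_sum_erase _ _ hmem, Sq_zero, mono_mul_nat,
      Sq_pow_two_pow, if_pos (Dvd.intro _ rfl), Nat.mul_div_cancel_left _ hpos,
      eq_comm, ← eq_sub_iff_add_eq] at hc
    rw [hc]
    refine Submodule.sub_mem _ (Submodule.mem_sup_left
      (Sq_mono_mem_hitsIn (Nat.mul_pos hpos hK) ?_)) (Submodule.sum_mem _ fun p hp => ?_)
    · simp only [Pi.add_apply, sum_add_distrib, ← mul_sum, ← hD]
      ring
    · obtain ⟨hne, hp⟩ := mem_erase.1 hp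
      rw [HasAntidiagonal.mem_antidiagonal] at hp
      obtain ⟨j, m⟩ := p
      simp only at hp ⊢
      have hj : j ≠ 0 := by
        rintro rfl
        exact hne (by simp at hp; simp [hp])
      rw [Sq_pow_two_pow]
      split_ifs with hdvd
      swap
      · simp
      obtain ⟨m, rfl⟩ := hdvd
      rw [Nat.mul_div_cancel_left _ hpos, Sq_mono, Sq_mono, sum_pow_char_pow, sum_mul_sum]
      refine Submodule.mem_sup_right (Submodule.sum_mem _ fun t ht =>
        Submodule.sum_mem _ fun u hu => ?_)
      rw [← mono_mul_nat, ← mono_add]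
      rw [mem_sqTerms] at ht hu
      refine mono_mem_monoSpan ?_ ?_
      · simp only [Pi.add_apply, sum_add_distrib, ← mul_sum, ht.1, hu.1, ← hD]
        rw [mul_add, mul_add, ← hp]
        ring
      · refine lowerBefore_add (fun i => g i + u i) ht.2 ?_
        -- If 2^k divides every t i ≤ l i < 2^k, then t = 0, which contradicts j ≠ 0.
        by_contra hall
        push Not at hall
        refine hj ?_
        rw [← ht.1]
        refine sum_eq_zero fun i _ => Nat.eq_zero_of_dvd_of_lt (hall i) ?_
        exact (le_of_testBit_imp (ht.2 i)).trans_lt (hl i)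

/-! ### Degrees and `ω`-vectors -/

theorem omega_le (F : BinArray n) (j : ℕ) : omega F j ≤ n := by
  simpa [omega] using card_le_univ (column F j)

theorem sum_mod_two_pow (e : Fin n → ℕ) (k : ℕ) :
    ∑ i, e i % 2 ^ k = ∑ j ∈ range k, omega (bits e) j * 2 ^ j := by
  induction k with
  | zero => simp [Nat.mod_one]
  | succ k ih =>
    rw [sum_range_succ, ← ih, omega, card_eq_sum_ones, sum_mul, column, sum_filter,
      ← sum_add_distrib]
    refine sum_congr rfl fun i _ => ?_
    rw [pow_succ, Nat.mod_mul, bits, Nat.testBit_eq_decide_div_mod_eq]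
    rcases Nat.mod_two_eq_zero_or_one (e i / 2 ^ k) with h | h <;> simp [h]

theorem sum_eq_range_add_div (e : Fin n → ℕ) (k : ℕ) :
    ∑ i, e i = ∑ j ∈ range k, omega (bits e) j * 2 ^ j + 2 ^ k * ∑ i, e i / 2 ^ k := by
  rw [← sum_mod_two_pow, mul_sum, ← sum_add_distrib]
  exact sum_congr rfl fun i _ => (Nat.mod_add_div _ _).symm

theorem omega_bits_div (e : Fin n → ℕ) (k j : ℕ) :
    omega (bits fun i => e i / 2 ^ k) j = omega (bits e) (k + j) := by
  unfold omega
  congr 1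
  ext i
  rw [mem_column_bits, mem_column_bits, Nat.testBit_div_two_pow, add_comm]

theorem sum_div_two_pow (e : Fin n → ℕ) (k : ℕ) :
    ∑ i, e i / 2 ^ k = omega (bits e) k + 2 * ∑ i, e i / 2 ^ (k + 1) := by
  have := sum_eq_range_add_div (fun i => e i / 2 ^ k) 1
  simpa [omega_bits_div, Nat.div_div_eq_div_mul, ← pow_succ] using this

theorem lt_two_pow_of_omega {e : Fin n → ℕ} {L : ℕ} (h : ∀ j, L ≤ j → omega (bits e) j = 0)
    (i : Fin n) : e i < 2 ^ L := by
  refine Nat.lt_pow_two_of_testBit _ fun j hj => ?_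
  have h0 : column (bits e) j = ∅ := card_eq_zero.1 (h j hj)
  by_contra hne
  have : i ∈ column (bits e) j := mem_column_bits.2 (by simpa using hne)
  simp [h0] at this

theorem sum_eq_of_omega {e : Fin n → ℕ} {L : ℕ} (h : ∀ j, L ≤ j → omega (bits e) j = 0) :
    ∑ i, e i = ∑ j ∈ range L, omega (bits e) j * 2 ^ j := by
  rw [sum_eq_range_add_div e L, sum_eq_zero (s := univ), mul_zero, add_zero]
  exact fun i _ => Nat.div_eq_of_lt (lt_two_pow_of_omega h i)

theorem exists_omega_eq_zero (e : Fin n → ℕ) : ∃ L, ∀ j, L ≤ j → omega (bits e) j = 0 := by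
  refine ⟨∑ i, e i, fun j hj => card_eq_zero.2 (eq_empty_of_forall_notMem fun i hi => ?_)⟩
  rw [mem_column_bits] at hi
  have h1 : e i ≤ ∑ i, e i := single_le_sum (fun _ _ => Nat.zero_le _) (mem_univ i)
  have h2 := Nat.testBit_lt_two_pow ((h1.trans hj).trans_lt Nat.lt_two_pow_self)
  simp [h2] at hi

theorem exists_bits_column_eq (C : ℕ → Finset (Fin n)) {L : ℕ} (hC : ∀ j, L ≤ j → C j = ∅) :
    ∃ e : Fin n → ℕ, ∀ j, column (bits e) j = C j := by
  refine ⟨fun i => Nat.ofBits fun j : Fin L => decide (i ∈ C j), fun j => ?_⟩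
  ext i
  rw [mem_column_bits, Nat.testBit_ofBits]
  split_ifs with h
  · simp
  · simp [hC j (not_lt.1 h)]

theorem exists_bits_omega_eq {w : ℕ → ℕ} (hw : ∀ j, w j ≤ n) {L : ℕ}
    (hL : ∀ j, L ≤ j → w j = 0) : ∃ e : Fin n → ℕ, omega (bits e) = w := by
  obtain ⟨e, he⟩ := exists_bits_column_eq
    (fun j => (univ : Finset (Fin n)).filter fun i => (i : ℕ) < w j) (L := L)
    (fun j hj => by simp [hL j hj])
  refine ⟨e, funext fun j => ?_⟩
  rw [omega, he, Fin.card_filter_val_lt, min_eq_right (hw j)]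

theorem isDescendingOmega_iff {d : ℕ} {w : ℕ → ℕ} :
    IsDescendingOmega n d w ↔
      Antitone w ∧ ∃ e : Fin n → ℕ, ∑ i, e i = d ∧ omega (bits e) = w := by
  refine and_congr_right fun _ => ⟨?_, ?_⟩
  · rintro ⟨e, rfl, h⟩
    exact ⟨e, (Finsupp.degree_eq_sum e).symm, h⟩
  · rintro ⟨e, rfl, h⟩
    refine ⟨Finsupp.equivFunOnFinite.symm e, ?_, h⟩
    simp [Finsupp.degree_eq_sum]

/-! ### Sums of numbers `2 ^ a - 1` -/

/-- `T` is the sum of `m` numbers of the form `2 ^ a - 1`. -/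
def IsSpikeSum (m T : ℕ) : Prop :=
  ∃ s : Multiset ℕ, s.card = m ∧ (s.map fun a => 2 ^ a - 1).sum = T

theorem IsSpikeSum.succ {m T : ℕ} (h : IsSpikeSum m T) : IsSpikeSum (m + 1) T := by
  obtain ⟨s, rfl, rfl⟩ := h
  exact ⟨0 ::ₘ s, by simp, by simp⟩

/-- One positive term is split by 2^(b+1) - 1 = 2 (2^b - 1) + 1, which loses 1. -/
theorem IsSpikeSum.split {m T : ℕ} (h : IsSpikeSum m (T + 1)) : IsSpikeSum (m + 1) T := by
  obtain ⟨s, rfl, hT⟩ := h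
  have hex : ∃ a ∈ s, a ≠ 0 := by
    by_contra hno
    push Not at hno
    have : (s.map fun a => 2 ^ a - 1).sum = 0 :=
      Multiset.sum_eq_zero fun x hx => by
        obtain ⟨a, ha, rfl⟩ := Multiset.mem_map.1 hx
        simp [hno a ha]
    omega
  obtain ⟨a, ha, h0⟩ := hex
  obtain ⟨t, rfl⟩ := Multiset.exists_cons_of_mem ha
  obtain ⟨b, rfl⟩ := Nat.exists_eq_succ_of_ne_zero h0
  refine ⟨b ::ₘ b ::ₘ t, by simp, ?_⟩
  simp only [Multiset.map_cons, Multiset.sum_cons] at hT ⊢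
  have := Nat.one_le_two_pow (n := b)
  rw [Nat.succ_eq_add_one, pow_succ] at hT
  omega

/-- Each of δ splittings costs 1 and adds a term; a zero term after each keeps the parity of the
number of terms. -/
theorem IsSpikeSum.add_two_mul {m T : ℕ} (δ : ℕ) (h : IsSpikeSum m (T + δ)) :
    IsSpikeSum (m + 2 * δ) T := by
  induction δ generalizing m with
  | zero => simpa using h
  | succ δ ih =>
    have := ih (m := m + 2) (IsSpikeSum.succ (IsSpikeSum.split (by rwa [add_assoc])))
    rwa [show m + 2 + 2 * δ = m + 2 * (δ + 1) by ring] at this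

theorem sum_countP_mul_two_pow (s : Multiset ℕ) {L : ℕ} (hL : ∀ a ∈ s, a ≤ L) :
    ∑ j ∈ range L, s.countP (fun a => j < a) * 2 ^ j = (s.map fun a => 2 ^ a - 1).sum := by
  induction s using Multiset.induction_on with
  | empty => simp
  | cons a s ih =>
    rw [Multiset.map_cons, Multiset.sum_cons, ← ih fun b hb => hL b (Multiset.mem_cons_of_mem hb)]
    simp_rw [Multiset.countP_cons, add_mul, sum_add_distrib, ite_mul, one_mul, zero_mul]
    rw [← sum_filter, add_comm]
    congr 1
    have : (range L).filter (fun j => j < a) = range a := by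
      ext j
      have := hL a (Multiset.mem_cons_self a s)
      simp only [mem_filter, mem_range]
      omega
    rw [this, Nat.geomSum_eq le_rfl]
    simp

theorem antitone_countP (s : Multiset ℕ) : Antitone fun j => s.countP fun a => j < a :=
  fun _ _ hij => by
    simp only [Multiset.countP_eq_card_filter]
    exact Multiset.card_le_card (Multiset.monotone_filter_right s fun _ h => hij.trans_lt h)

/-- This is the conjugate partition: the i-th part counts the columns longer than i, with zeros
padding to m parts. -/
theorem exists_multiset_countP {w : ℕ → ℕ} (hw : Antitone w) {m L : ℕ} (h0 : w 0 ≤ m)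
    (hL : ∀ j, L ≤ j → w j = 0) :
    ∃ s : Multiset ℕ, s.card = m ∧ (∀ a ∈ s, a ≤ L) ∧
      ∀ j, w j = s.countP fun a => j < a := by
  have hlt : ∀ i j, j < #{l ∈ range L | i < w l} ↔ i < w j := by
    intro i j
    constructor
    · intro h
      by_contra hj
      have hsub : {l ∈ range L | i < w l} ⊆ range j := by
        intro l hl
        rw [mem_range]
        by_contra hjl
        exact hj ((mem_filter.1 hl).2.trans_le (hw (not_lt.1 hjl)))
      have := card_le_card hsub
      rw [card_range] at this
      omega
    · intro h
      have hjL : j < L := by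
        by_contra hc
        rw [hL j (not_lt.1 hc)] at h
        omega
      have hsub : range (j + 1) ⊆ {l ∈ range L | i < w l} := by
        intro l hl
        rw [mem_range] at hl
        rw [mem_filter, mem_range]
        exact ⟨by omega, h.trans_le (hw (by omega))⟩
      simpa using card_le_card hsub
  refine ⟨(Multiset.range m).map fun i => #{l ∈ range L | i < w l}, by simp, ?_, fun j => ?_⟩
  · intro a ha
    obtain ⟨i, -, rfl⟩ := Multiset.mem_map.1 ha
    simpa using card_filter_le (range L) fun l => i < w l
  · rw [Multiset.countP_map]
    simp only [hlt]
    have : (Multiset.range m).filter (fun i => i < w j) = Multiset.range (w j) := by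
      have h1 : (range m).filter (fun i => i < w j) = range (w j) := by
        ext i
        have := hw (Nat.zero_le j)
        simp only [mem_filter, mem_range]
        omega
      exact congrArg Finset.val h1
    rw [this, Multiset.card_range]

theorem exists_multiset_of_antitone {e : Fin n → ℕ} (hw : Antitone (omega (bits e))) {m : ℕ}
    (h0 : omega (bits e) 0 ≤ m) :
    ∃ s : Multiset ℕ, s.card = m ∧ (s.map fun a => 2 ^ a - 1).sum = ∑ i, e i ∧
      ∀ j, omega (bits e) j = s.countP fun a => j < a := by
  obtain ⟨L, hL⟩ := exists_omega_eq_zero e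
  obtain ⟨s, hs, hsL, hsw⟩ := exists_multiset_countP hw h0 hL
  refine ⟨s, hs, ?_, hsw⟩
  rw [sum_eq_of_omega hL, ← sum_countP_mul_two_pow s hsL]
  simp_rw [hsw]

theorem isSpikeSum_of_antitone {e : Fin n → ℕ} (hw : Antitone (omega (bits e))) (k : ℕ) :
    IsSpikeSum (omega (bits e) k) (∑ i, e i / 2 ^ (k + 1)) := by
  have hdiv : omega (bits fun i => e i / 2 ^ (k + 1)) = fun j => omega (bits e) (k + 1 + j) :=
    funext fun j => omega_bits_div e (k + 1) j
  obtain ⟨s, hs, hsum, -⟩ := exists_multiset_of_antitone (e := fun i => e i / 2 ^ (k + 1))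
    (m := omega (bits e) k) (by rw [hdiv]; exact fun i j hij => hw (by omega))
    (by rw [hdiv]; exact hw (by omega))
  exact ⟨s, hs, hsum⟩

/-- The columns after k are replaced by the conjugate of the spike sum. It has `omega (bits e) k`
terms, so none of the new columns is longer than column k. -/
theorem exists_isDescendingOmega_extending {e : Fin n → ℕ} {k : ℕ}
    (hanti : ∀ j < k, omega (bits e) (j + 1) ≤ omega (bits e) j)
    (hs : IsSpikeSum (omega (bits e) k) (∑ i, e i / 2 ^ (k + 1))) :
    ∃ w, IsDescendingOmega n (∑ i, e i) w ∧ ∀ j ≤ k, w j = omega (bits e) j := by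
  obtain ⟨s, hcard, hsum⟩ := hs
  set v := omega (bits e)
  set w : ℕ → ℕ := fun j => if j ≤ k then v j else s.countP fun a => j - (k + 1) < a with hw
  have hcount : ∀ j, (s.countP fun a => j < a) ≤ v k := fun j =>
    (Multiset.countP_le_card _ _).trans hcard.le
  have hwle : ∀ j ≤ k, w j = v j := fun j hj => by simp [hw, hj]
  have hwgt : ∀ j, w (k + 1 + j) = s.countP fun a => j < a := fun j => by
    have : ¬ k + 1 + j ≤ k := by omega
    simp [hw, this]
  have hwanti : Antitone w := by
    refine antitone_nat_of_succ_le fun j => ?_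
    rcases lt_trichotomy j k with h | h | h
    · rw [hwle j h.le, hwle (j + 1) h]; exact hanti j h
    · subst h
      rw [hwle j le_rfl]
      exact (hwgt 0).trans_le (hcount 0)
    · obtain ⟨l, rfl⟩ := Nat.exists_eq_add_of_le (Nat.succ_le_of_lt h)
      rw [Nat.succ_eq_add_one, add_assoc, hwgt, hwgt]
      exact antitone_countP s (Nat.le_succ l)
  have hwn : ∀ j, w j ≤ n := fun j => by
    refine (hwanti (Nat.zero_le j)).trans ?_
    rw [hwle 0 (Nat.zero_le k)]
    exact omega_le _ _
  have hsup : ∀ a ∈ s, a ≤ s.sup := fun a ha => Multiset.le_sup ha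
  have hwzero : ∀ j, k + 1 + s.sup ≤ j → w j = 0 := by
    intro j hj
    obtain ⟨l, rfl⟩ := Nat.exists_eq_add_of_le hj
    rw [add_assoc, hwgt, Multiset.countP_eq_zero]
    intro a ha
    have := hsup a ha
    omega
  obtain ⟨e', he'⟩ := exists_bits_omega_eq hwn hwzero
  refine ⟨w, isDescendingOmega_iff.2 ⟨hwanti, e', ?_, he'⟩, hwle⟩
  rw [sum_eq_of_omega (L := k + 1 + s.sup) (by rwa [he']), he', sum_range_add,
    sum_eq_range_add_div e (k + 1), ← hsum, ← sum_countP_mul_two_pow s hsup, mul_sum]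
  congr 1
  · exact sum_congr rfl fun j hj => by rw [hwle j (Nat.lt_succ_iff.1 (mem_range.1 hj))]
  · exact sum_congr rfl fun j _ => by rw [hwgt, pow_add]; ring

/-! ### Row-regular degrees -/

/-- Merging two equal powers 2^a into 2^(a+1) keeps the sum and shortens the multiset; without
repetitions it is the binary expansion. Hence the expansion is the unique shortest representation.
-/
theorem card_le_of_sum_two_pow_eq (S : Finset ℕ) (s : Multiset ℕ)
    (h : (s.map fun a => 2 ^ a).sum = ∑ a ∈ S, 2 ^ a) : #S ≤ s.card ∧ (s.card ≤ #S → s = S.val) := by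
  induction hc : s.card generalizing s with
  | zero =>
    rw [Multiset.card_eq_zero] at hc
    subst hc
    have : S = ∅ := by
      by_contra hne
      obtain ⟨a, ha⟩ := nonempty_iff_ne_empty.2 hne
      have := sum_pos (f := fun a => 2 ^ a) (s := S) (fun a _ => by positivity) ⟨a, ha⟩
      simp at h
      omega
    simp [this]
  | succ c ih =>
    by_cases hnd : s.Nodup
    · have hS : (⟨s, hnd⟩ : Finset ℕ) = S := geomSum_injective le_rfl h
      subst hS
      exact ⟨hc.le, fun _ => rfl⟩
    · rw [Multiset.nodup_iff_count_le_one] at hnd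
      push Not at hnd
      obtain ⟨a, ha⟩ := hnd
      obtain ⟨t, rfl⟩ := Multiset.le_iff_exists_add.1 (Multiset.le_count_iff_replicate_le.1 ha)
      have hc' : ((a + 1) ::ₘ t).card = c := by
        simp at hc ⊢; omega
      have := (ih ((a + 1) ::ₘ t) (by
        rw [← h]
        simp [Multiset.replicate_succ]
        ring) hc').1
      omega

theorem existsUnique_isDescendingOmega_of_isRowRegular {d : ℕ} (h : IsRowRegular n d) :
    ∃! w : ℕ → ℕ, IsDescendingOmega n d w := by
  classical
  obtain ⟨lam, hlam, rfl⟩ := h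
  set s₀ : Multiset ℕ := (univ : Finset (Fin n)).val.map lam with hs₀
  have hcard : s₀.card = n := by simp [hs₀]
  have hsum₀ : (s₀.map fun a => 2 ^ a - 1).sum = ∑ i, (2 ^ lam i - 1) := by
    rw [hs₀, Multiset.map_map]; rfl
  have hadd : ∀ s : Multiset ℕ, (s.map fun a => 2 ^ a).sum =
      (s.map fun a => 2 ^ a - 1).sum + s.card := by
    intro s
    induction s using Multiset.induction_on with
    | empty => simp
    | cons a s ih =>
      have := Nat.one_le_two_pow (n := a)
      simp only [Multiset.map_cons, Multiset.sum_cons, Multiset.card_cons, ih]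
      omega
  have hsup : ∀ a ∈ s₀, a ≤ s₀.sup := fun a ha => Multiset.le_sup ha
  have hzero : ∀ j, s₀.sup ≤ j → (s₀.countP fun a => j < a) = 0 := fun j hj => by
    rw [Multiset.countP_eq_zero]
    intro a ha
    have := hsup a ha
    omega
  refine ⟨fun j => s₀.countP fun a => j < a, ?_, ?_⟩
  · obtain ⟨e, he⟩ := exists_bits_omega_eq (n := n) (w := fun j => s₀.countP fun a => j < a)
      (fun j => (Multiset.countP_le_card _ _).trans hcard.le) hzero
    refine isDescendingOmega_iff.2 ⟨antitone_countP s₀, e, ?_, he⟩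
    rw [sum_eq_of_omega (L := s₀.sup) (by rwa [he]), he, ← hsum₀, ← sum_countP_mul_two_pow s₀ hsup]
  · intro w hw
    obtain ⟨hanti, e, hd, rfl⟩ := isDescendingOmega_iff.1 hw
    obtain ⟨s, hs, hsum, hsw⟩ := exists_multiset_of_antitone hanti (omega_le _ 0)
    have hval : (univ.image lam).val = s₀ := by
      rw [image_val_of_injOn hlam.injective.injOn]
    have hS := (card_le_of_sum_two_pow_eq (univ.image lam) s (by
      rw [hadd s, hsum, hd, hs, sum_eq_multiset_sum (univ.image lam), hval, hadd, hsum₀, hcard])).2 (by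
      rw [card_def, hval, hcard, hs])
    rw [hval] at hS
    subst hS
    exact funext hsw

/-! ### Monomials of a fixed degree -/

instance finite_exponents (n d : ℕ) : Finite {e : Fin n → ℕ // ∑ i, e i = d} := by
  refine Set.Finite.subset (Fintype.piFinset fun _ : Fin n => range (d + 1)).finite_toSet ?_
  intro e he
  rw [mem_coe, Fintype.mem_piFinset]
  intro i
  rw [mem_range, Nat.lt_succ_iff, ← he]
  exact single_le_sum (fun _ _ => Nat.zero_le _) (mem_univ i)

theorem omega_eq_of_column {e f : Fin n → ℕ} {j : ℕ}
    (h : ∀ i, (e i).testBit j = (f i).testBit j) : omega (bits e) j = omega (bits f) j := by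
  unfold omega
  congr 1
  ext i
  rw [mem_column_bits, mem_column_bits, h]

theorem monoSpan_le {d : ℕ} {p : (Fin n → ℕ) → Prop} {V : Submodule (ZMod 2) (P n)}
    (h : ∀ e : Fin n → ℕ, ∑ i, e i = d → p e → mono e ∈ V) : monoSpan d p ≤ V := by
  refine Submodule.span_le.2 ?_
  rintro _ ⟨e, hd, hp, rfl⟩
  exact h e hd hp

/-! ### Monomials below the unique descending vector -/

theorem mono_mem_hitsIn_of_lex_lt {d : ℕ} {ws : ℕ → ℕ} (hws : Antitone ws)
    (huniq : ∀ w, IsDescendingOmega n d w → w = ws) (e : Fin n → ℕ) (hd : ∑ i, e i = d)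
    (hlt : toLex (omega (bits e)) < toLex ws) : mono e ∈ hitsIn n d := by
  let r : {e : Fin n → ℕ // ∑ i, e i = d} → {e : Fin n → ℕ // ∑ i, e i = d} → Prop :=
    fun a b => toLex (omega (bits a.1)) < toLex (omega (bits b.1))
  have : IsTrans _ r := ⟨fun _ _ _ h h' => lt_trans h h'⟩
  have : Std.Irrefl r := ⟨fun _ => lt_irrefl _⟩
  have hwf : WellFounded r := Finite.wellFounded_of_trans_of_irrefl r
  suffices H : ∀ a : {e : Fin n → ℕ // ∑ i, e i = d},
      toLex (omega (bits a.1)) < toLex ws → mono a.1 ∈ hitsIn n d from H ⟨e, hd⟩ hlt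
  intro a
  induction a using hwf.induction with
  | _ a ih =>
    obtain ⟨e, hd⟩ := a
    intro hlt
    obtain ⟨k, hk, hkk⟩ := hlt
    change ∀ j < k, omega (bits e) j = ws j at hk
    change omega (bits e) k < ws k at hkk
    set A := column (bits e) k with hA
    -- Such two-powers, lowered by 1 each, would form a spike sum completing the columns up to k to
    -- a descending vector different from `ws`.
    have hno : ¬ ∃ a : Fin n → ℕ, ∑ i ∈ A, 2 ^ a i = #A + ∑ i, e i / 2 ^ (k + 1) := by
      rintro ⟨a, ha⟩
      have hs : IsSpikeSum (omega (bits e) k) (∑ i, e i / 2 ^ (k + 1)) := by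
        refine ⟨A.val.map a, by simp [omega, hA], ?_⟩
        have h1 : ∑ i ∈ A, 2 ^ a i = ∑ i ∈ A, (2 ^ a i - 1) + #A := by
          rw [card_eq_sum_ones, ← sum_add_distrib]
          exact sum_congr rfl fun i _ => (Nat.sub_add_cancel Nat.one_le_two_pow).symm
        rw [Multiset.map_map]
        change ∑ i ∈ A, (2 ^ a i - 1) = _
        omega
      obtain ⟨w, hw, hwe⟩ := exists_isDescendingOmega_extending (fun j hj => by
        rw [hk j hj]
        rcases (Nat.succ_le_of_lt hj).eq_or_lt with h | h
        · rw [← Nat.succ_eq_add_one, h]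
          refine hkk.le.trans (hws hj.le)
        · rw [hk _ h]; exact hws (Nat.le_succ j)) hs
      have := hwe k le_rfl
      rw [huniq w (hd ▸ hw)] at this
      omega
    have hmem := mono_mul_pow_mem (k := k) (l := fun i => e i % 2 ^ k)
      (fun i => Nat.mod_lt _ (by positivity))
      (mono_indicator_mul_sq_mem A (fun i => e i / 2 ^ (k + 1)) hno)
    have hdeg : ∑ i, e i % 2 ^ k + 2 ^ k * (#A + 2 * ∑ i, e i / 2 ^ (k + 1)) = d := by
      have h1 := sum_eq_range_add_div e k
      rw [sum_div_two_pow, ← sum_mod_two_pow, hd] at h1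
      exact h1.symm
    -- The exponents are cut into the columns before k, column k, and the columns after k.
    have hfac : mono (fun i => e i % 2 ^ k) *
        (mono (fun i => if i ∈ A then 1 else 0) * mono (fun i => e i / 2 ^ (k + 1)) ^ 2) ^ 2 ^ k
          = mono e := by
      rw [← mono_mul_nat 2, ← mono_add, ← mono_mul_nat, ← mono_add]
      congr 1
      funext i
      have h1 := Nat.mod_add_div (e i) (2 ^ k)
      have h2 := Nat.mod_add_div (e i / 2 ^ k) 2
      have h3 : (e i / 2 ^ k) % 2 = if i ∈ A then 1 else 0 := by
        simp only [hA, mem_column_bits, Nat.testBit_eq_decide_div_mod_eq]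
        rcases Nat.mod_two_eq_zero_or_one (e i / 2 ^ k) with h | h <;> simp [h]
      rw [Nat.div_div_eq_div_mul, ← pow_succ, h3] at h2
      simp only [Pi.add_apply]
      rw [h2, h1]
    rw [hdeg, hfac] at hmem
    refine (sup_le le_rfl (monoSpan_le fun e' hd' hlow => ?_)) hmem
    obtain ⟨c, hc, hceq, hclt⟩ := hlow
    have hom : ∀ j < k, omega (bits fun i => e i % 2 ^ k) j = omega (bits e) j := fun j hj =>
      omega_eq_of_column fun i => by simp [Nat.testBit_mod_two_pow, hj]
    have hlt' : toLex (omega (bits e')) < toLex (omega (bits e)) :=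
      ⟨c, fun j hj => (hceq j hj).trans (hom j (lt_trans hj hc)), by
        have := hom c hc
        exact hclt.trans_eq this⟩
    exact ih ⟨e', hd'⟩ hlt' (hlt'.trans ⟨k, hk, hkk⟩)

/-! ### Monomials above the unique descending vector -/

/-- Otherwise the columns of e up to k descend. Column k exceeds `ws k` by an even number 2δ since
the degrees agree, and splitting δ terms of the tail of `ws` completes these columns to a second
descending vector. -/
theorem exists_lt_of_gt_descending {d : ℕ} {ws : ℕ → ℕ} (hws : IsDescendingOmega n d ws)
    (huniq : ∀ w, IsDescendingOmega n d w → w = ws) {e : Fin n → ℕ} (hd : ∑ i, e i = d) {k : ℕ}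
    (hk : ∀ j < k, omega (bits e) j = ws j) (hkk : ws k < omega (bits e) k) :
    ∃ l, k = l + 1 ∧ omega (bits e) l < omega (bits e) k := by
  by_contra hno
  push Not at hno
  obtain ⟨hanti, es, hds, rfl⟩ := isDescendingOmega_iff.1 hws
  have hpre : ∑ i, e i / 2 ^ k = ∑ i, es i / 2 ^ k := by
    have h1 := sum_eq_range_add_div e k
    have h2 := sum_eq_range_add_div es k
    have h3 : ∑ j ∈ range k, omega (bits e) j * 2 ^ j =
        ∑ j ∈ range k, omega (bits es) j * 2 ^ j :=
      sum_congr rfl fun j hj => by rw [hk j (mem_range.1 hj)]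
    rw [hd, ← hds, h2, h3] at h1
    exact (Nat.eq_of_mul_eq_mul_left (Nat.two_pow_pos k) (Nat.add_left_cancel h1)).symm
  rw [sum_div_two_pow e, sum_div_two_pow es] at hpre
  obtain ⟨δ, hδ⟩ : ∃ δ, ∑ i, es i / 2 ^ (k + 1) = ∑ i, e i / 2 ^ (k + 1) + δ :=
    Nat.exists_eq_add_of_le (by omega)
  have hs := isSpikeSum_of_antitone hanti k
  rw [hδ] at hs
  have hs' := hs.add_two_mul
  rw [show omega (bits es) k + 2 * δ = omega (bits e) k by omega] at hs'
  obtain ⟨w, hw, hwe⟩ := exists_isDescendingOmega_extending (fun j hj => by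
    rcases (Nat.succ_le_of_lt hj).eq_or_lt with h | h
    · rw [← Nat.succ_eq_add_one, h]; exact hno j h.symm
    · rw [hk j hj, hk _ h]; exact hanti (Nat.le_succ j)) hs'
  have := hwe k le_rfl
  rw [huniq w (hd ▸ hw)] at this
  omega

/-! ### Increasing the exponents raises the right columns -/

/-- In the last column where the arrays differ, a digit 1 in y over a digit 0 in z would make that
row of y larger, so the column of y is properly contained in that of z. -/
theorem colex_omega_lt {y z : Fin n → ℕ} (hle : ∀ i, y i ≤ z i) (hlt : ∃ i, y i < z i) :
    toColex (omega (bits y)) < toColex (omega (bits z)) := by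
  classical
  have hex : ∃ J, ∀ j, J ≤ j → ∀ i, (y i).testBit j = (z i).testBit j := by
    obtain ⟨L, hL⟩ := exists_omega_eq_zero z
    refine ⟨L, fun j hj i => ?_⟩
    have hz := (lt_two_pow_of_omega hL i).trans_le (Nat.pow_le_pow_right two_pos hj)
    rw [Nat.testBit_lt_two_pow hz, Nat.testBit_lt_two_pow ((hle i).trans_lt hz)]
  have hspec := Nat.find_spec hex
  have hmin := fun m => Nat.find_min hex (m := m)
  set J := Nat.find hex
  rcases Nat.eq_zero_or_pos J with h0 | hpos
  · obtain ⟨i, hi⟩ := hlt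
    exact absurd (Nat.eq_of_testBit_eq fun j => hspec j (by omega) i) hi.ne
  · obtain ⟨m, hm⟩ := Nat.exists_eq_succ_of_ne_zero hpos.ne'
    have hsub : ∀ i, (y i).testBit m = true → (z i).testBit m = true := by
      intro i hi
      by_contra hz
      refine (hle i).not_gt (Nat.lt_of_testBit m (by simpa using hz) hi fun j hj => ?_)
      exact (hspec j (by omega) i).symm
    have hne : ∃ i, (y i).testBit m ≠ (z i).testBit m := by
      by_contra hall
      push Not at hall
      refine hmin m (by omega) fun j hj i => ?_
      rcases hj.eq_or_lt with rfl | h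
      · exact hall i
      · exact hspec j (by omega) i
    refine ⟨m, fun j (hj : m < j) => omega_eq_of_column fun i => hspec j (by omega) i, ?_⟩
    obtain ⟨i, hi⟩ := hne
    change #(column (bits y) m) < #(column (bits z) m)
    refine card_lt_card ((ssubset_iff_of_subset fun i hi => ?_).2 ⟨i, ?_, ?_⟩)
    · rw [mem_column_bits] at hi ⊢
      exact hsub i hi
    · rw [mem_column_bits]
      by_contra hz
      exact hi (by
        have h1 : ¬ (y i).testBit m = true := fun h => hz (hsub i h)
        rw [Bool.not_eq_true] at h1 hz
        rw [h1, hz])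
    · rw [mem_column_bits]
      intro hy
      exact hi (by rw [hy, hsub i hy])

theorem colex_omega_lt_of_div {k : ℕ} {y z : Fin n → ℕ}
    (hle : ∀ i, y i / 2 ^ k ≤ z i / 2 ^ k) (hlt : ∃ i, y i / 2 ^ k < z i / 2 ^ k) :
    toColex (omega (bits y)) < toColex (omega (bits z)) := by
  obtain ⟨m, hm, hmm⟩ := colex_omega_lt hle hlt
  refine ⟨k + m, fun j (hj : k + m < j) => ?_, ?_⟩
  · obtain ⟨l, rfl⟩ := Nat.exists_eq_add_of_le (show k ≤ j by omega)
    have := hm l (show m < l by omega)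
    simpa only [Pi.toColex_apply, omega_bits_div] using this
  · simpa only [Pi.toColex_apply, omega_bits_div] using hmm

/-! ### Moving digits between adjacent columns -/

theorem testBit_add_two_pow {k x : ℕ} (h0 : x.testBit k = true) (h1 : x.testBit (k + 1) = false)
    (j : ℕ) : (x + 2 ^ k).testBit j =
      if j = k then false else if j = k + 1 then true else x.testBit j := by
  induction k generalizing x j with
  | zero =>
    rw [Nat.testBit_zero] at h0
    rw [Nat.testBit_succ, Nat.testBit_zero] at h1
    simp only [decide_eq_true_eq, decide_eq_false_iff_not] at h0 h1
    rcases j with _ | _ | j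
    · simp; omega
    · simp [Nat.testBit_succ]; omega
    · simp only [Nat.testBit_succ, pow_zero]
      rw [show (x + 1) / 2 / 2 = x / 2 / 2 by omega]
      simp
  | succ k ih =>
    rw [Nat.testBit_succ] at h0 h1
    have hdiv : (x + 2 ^ (k + 1)) / 2 = x / 2 + 2 ^ k := by rw [pow_succ]; omega
    rcases j with _ | j
    · simp only [Nat.testBit_zero]
      rw [pow_succ]
      simp
    · rw [Nat.testBit_succ, hdiv, ih h0 h1, Nat.testBit_succ]
      simp

theorem exists_eq_add_two_pow {k x : ℕ} (h0 : x.testBit k = false)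
    (h1 : x.testBit (k + 1) = true) :
    ∃ r, r.testBit k = true ∧ r.testBit (k + 1) = false ∧ x = r + 2 ^ k := by
  refine ⟨x ^^^ 2 ^ k ^^^ 2 ^ (k + 1), ?_, ?_, ?_⟩
  · simp [Nat.testBit_xor, h0]
  · simp [Nat.testBit_xor, h1]
  · refine Nat.eq_of_testBit_eq fun j => ?_
    rw [testBit_add_two_pow]
    · split_ifs with hj hj'
      · rw [hj, h0]
      · rw [hj', h1]
      · simp [Nat.testBit_xor, Ne.symm hj, Ne.symm hj']
    · simp [Nat.testBit_xor, h0]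
    · simp [Nat.testBit_xor, h1]

/-- A digit of t in a column j > k doubles a digit of x and carries out of column j; a digit 2^k
added to digits 1, 1 carries through both columns. Either would raise the quotient by 2^(k+2). -/
theorem eq_two_pow_of_div_le {k x t : ℕ} (hsub : ∀ j, t.testBit j = true → x.testBit j = true)
    (hdvd : 2 ^ k ∣ t) (ht : t ≠ 0) (hle : (x + t) / 2 ^ (k + 2) ≤ x / 2 ^ (k + 2)) :
    t = 2 ^ k ∧ x.testBit k = true ∧ x.testBit (k + 1) = false := by
  have carry : ∀ j, k + 1 ≤ j → x % 2 ^ (j + 1) + t < 2 ^ (j + 1) := by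
    intro j hj
    by_contra hc
    have h1 : x / 2 ^ (j + 1) + 1 ≤ (x + t) / 2 ^ (j + 1) := by
      rw [Nat.le_div_iff_mul_le (by positivity)]
      have := Nat.mod_add_div x (2 ^ (j + 1))
      rw [add_mul, mul_comm]
      omega
    obtain ⟨m, rfl⟩ := Nat.exists_eq_add_of_le hj
    have h2 := Nat.div_le_div_right (c := 2 ^ m) hle
    rw [Nat.div_div_eq_div_mul, Nat.div_div_eq_div_mul, ← pow_add] at h2
    rw [show k + 2 + m = k + 1 + m + 1 by ring] at h2
    omega
  have hbit : ∀ j, x.testBit j = true → 2 ^ j ≤ x % 2 ^ (j + 1) := fun j hj =>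
    Nat.ge_two_pow_of_testBit (by simp [Nat.testBit_mod_two_pow, hj])
  have hhigh : ∀ j, k + 1 ≤ j → t.testBit j = false := by
    intro j hj
    by_contra hne
    rw [Bool.not_eq_false] at hne
    have h1 := hbit j (hsub j hne)
    have h2 := Nat.ge_two_pow_of_testBit hne
    have h3 := carry j hj
    rw [pow_succ] at h3
    rw [pow_succ] at h1
    omega
  have hteq : t = 2 ^ k := by
    obtain ⟨s, rfl⟩ := hdvd
    have hlt : 2 ^ k * s < 2 ^ (k + 1) := Nat.lt_pow_two_of_testBit _ hhigh
    have hs : s < 2 := by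
      rw [pow_succ] at hlt
      exact Nat.lt_of_mul_lt_mul_left hlt
    have : s = 1 := by
      have : s ≠ 0 := by rintro rfl; simp at ht
      omega
    simp [this]
  have hxk : x.testBit k = true := hsub k (by simp [hteq])
  refine ⟨hteq, hxk, ?_⟩
  by_contra hne
  rw [Bool.not_eq_false] at hne
  have h3 := carry (k + 1) le_rfl
  have h1 := hbit (k + 1) hne
  have h4 : 2 ^ k ≤ x % 2 ^ (k + 1) := hbit k hxk
  have h5 : x % 2 ^ (k + 1 + 1) = x % 2 ^ (k + 1) + 2 ^ (k + 1) := by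
    have : x / 2 ^ (k + 1) % 2 = 1 := by
      simpa [Nat.testBit_eq_decide_div_mod_eq] using hne
    rw [pow_succ 2 (k + 1), Nat.mod_mul, this, mul_one]
  rw [h5, hteq, pow_succ 2 (k + 1), pow_succ] at h3
  rw [pow_succ] at h4
  omega

/-- The order in which monomials are straightened: `f` has a larger `ω`-vector, compared from the
right, or the same `ω`-vector and larger exponents, compared from the last variable. -/
def Higher (e f : Fin n → ℕ) : Prop :=
  toColex (omega (bits e)) < toColex (omega (bits f)) ∨
    omega (bits e) = omega (bits f) ∧ toColex e < toColex f

theorem Higher.trans {e f g : Fin n → ℕ} (h : Higher e f) (h' : Higher f g) : Higher e g := by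
  rcases h with h | ⟨h1, h2⟩ <;> rcases h' with h' | ⟨h1', h2'⟩
  · exact Or.inl (h.trans h')
  · exact Or.inl (h1' ▸ h)
  · exact Or.inl (h1 ▸ h')
  · exact Or.inr ⟨h1.trans h1', h2.trans h2'⟩

theorem Higher.irrefl (e : Fin n → ℕ) : ¬ Higher e e := by
  rintro (h | ⟨-, h⟩) <;> exact lt_irrefl _ h

/-! ### Exchanging the digits of two adjacent columns -/

/-- The rows `i` of `S`, where `r i` has the digits `1, 0` in columns `k`, `k + 1`, get the digits
`1, 0` if `i ∈ X` and `0, 1` otherwise; the other rows are those of `e`. -/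
def place (e r : Fin n → ℕ) (k : ℕ) (S X : Finset (Fin n)) : Fin n → ℕ := fun i =>
  if i ∈ S then (if i ∈ X then r i else r i + 2 ^ k) else e i

/-- `e` is `place e r k S Y`, and its rows outside `S` have equal digits in columns `k`, `k + 1`. -/
structure IsPlacement (e r : Fin n → ℕ) (k : ℕ) (S Y : Finset (Fin n)) : Prop where
  subset : Y ⊆ S
  bit_left : ∀ i ∈ S, (r i).testBit k = true
  bit_right : ∀ i ∈ S, (r i).testBit (k + 1) = false
  eq : place e r k S Y = e
  bit_eq : ∀ i, i ∉ S → (e i).testBit k = (e i).testBit (k + 1)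

theorem exists_isPlacement (e : Fin n → ℕ) (k : ℕ) :
    ∃ r, IsPlacement e r k
      (column (bits e) k \ column (bits e) (k + 1) ∪ column (bits e) (k + 1) \ column (bits e) k)
      (column (bits e) k \ column (bits e) (k + 1)) := by
  set Y := column (bits e) k \ column (bits e) (k + 1) with hY
  set B := column (bits e) (k + 1) \ column (bits e) k with hB
  have hYm : ∀ i, i ∈ Y ↔ (e i).testBit k = true ∧ (e i).testBit (k + 1) = false := fun i => by
    simp [hY, mem_column_bits]
  have hBm : ∀ i, i ∈ B ↔ (e i).testBit (k + 1) = true ∧ (e i).testBit k = false := fun i => by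
    simp [hB, mem_column_bits]
  have hrow : ∀ i, ∃ r, i ∈ Y ∪ B → r.testBit k = true ∧ r.testBit (k + 1) = false ∧
      (if i ∈ Y then r else r + 2 ^ k) = e i := by
    intro i
    by_cases hiY : i ∈ Y
    · exact ⟨e i, fun _ => ⟨((hYm i).1 hiY).1, ((hYm i).1 hiY).2, by simp [hiY]⟩⟩
    · by_cases hiB : i ∈ B
      · obtain ⟨r, h1, h2, h3⟩ := exists_eq_add_two_pow ((hBm i).1 hiB).2 ((hBm i).1 hiB).1
        exact ⟨r, fun _ => ⟨h1, h2, by simp [hiY, h3]⟩⟩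
      · exact ⟨0, fun h => by simp [hiY, hiB] at h⟩
  choose r hr using hrow
  refine ⟨r, subset_union_left, fun i hi => (hr i hi).1, fun i hi => (hr i hi).2.1,
    funext fun i => ?_, fun i hi => ?_⟩
  · by_cases hi : i ∈ Y ∪ B
    · simp only [place, hi, if_true, (hr i hi).2.2]
    · simp only [place, hi, if_false]
  · rw [mem_union, hYm, hBm] at hi
    revert hi
    cases (e i).testBit k <;> cases (e i).testBit (k + 1) <;> simp

namespace IsPlacement

variable {e r : Fin n → ℕ} {k : ℕ} {S Y : Finset (Fin n)}

theorem testBit_left (h : IsPlacement e r k S Y) {X : Finset (Fin n)} {i : Fin n} (hi : i ∈ S) :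
    (place e r k S X i).testBit k = decide (i ∈ X) := by
  by_cases hX : i ∈ X
  · simp [place, hi, hX, h.bit_left i hi]
  · simp [place, hi, hX, testBit_add_two_pow (h.bit_left i hi) (h.bit_right i hi)]

theorem testBit_right (h : IsPlacement e r k S Y) {X : Finset (Fin n)} {i : Fin n} (hi : i ∈ S) :
    (place e r k S X i).testBit (k + 1) = !decide (i ∈ X) := by
  by_cases hX : i ∈ X
  · simp [place, hi, hX, h.bit_right i hi]
  · simp [place, hi, hX, testBit_add_two_pow (h.bit_left i hi) (h.bit_right i hi)]

theorem testBit_of_ne (h : IsPlacement e r k S Y) (X : Finset (Fin n)) (i : Fin n) {j : ℕ}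
    (hj : j ≠ k) (hj' : j ≠ k + 1) :
    (place e r k S X i).testBit j = (e i).testBit j := by
  have key : ∀ X : Finset (Fin n), i ∈ S → (place e r k S X i).testBit j = (r i).testBit j := by
    intro X hi
    by_cases hX : i ∈ X
    · simp [place, hi, hX]
    · simp [place, hi, hX, testBit_add_two_pow (h.bit_left i hi) (h.bit_right i hi), hj, hj']
  by_cases hi : i ∈ S
  · rw [key X hi, ← key Y hi, h.eq]
  · simp [place, hi]

theorem omega_of_ne (h : IsPlacement e r k S Y) (X : Finset (Fin n)) {j : ℕ}
    (hj : j ≠ k) (hj' : j ≠ k + 1) :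
    omega (bits (place e r k S X)) j = omega (bits e) j :=
  omega_eq_of_column fun i => h.testBit_of_ne X i hj hj'

theorem omega_left (h : IsPlacement e r k S Y) {X : Finset (Fin n)} (hX : X ⊆ S) :
    omega (bits (place e r k S X)) k = #(column (bits e) k \ S) + #X := by
  rw [omega, ← card_union_of_disjoint (disjoint_of_subset_right hX sdiff_disjoint)]
  congr 1
  ext i
  rw [mem_column_bits, mem_union, mem_sdiff, mem_column_bits]
  by_cases hi : i ∈ S
  · simp [h.testBit_left hi, hi]
  · have : i ∉ X := fun hx => hi (hX hx)
    simp [place, hi, this]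

theorem omega_right (h : IsPlacement e r k S Y) (X : Finset (Fin n)) :
    omega (bits (place e r k S X)) (k + 1) = #(column (bits e) (k + 1) \ S) + #(S \ X) := by
  rw [omega, ← card_union_of_disjoint (disjoint_of_subset_right sdiff_subset sdiff_disjoint)]
  congr 1
  ext i
  rw [mem_column_bits, mem_union, mem_sdiff, mem_sdiff, mem_column_bits]
  by_cases hi : i ∈ S
  · simp [h.testBit_right hi, hi]
  · simp [place, hi]

theorem omega_eq (h : IsPlacement e r k S Y) {X : Finset (Fin n)} (hX : X ⊆ S)
    (hcard : #X = #Y) : omega (bits (place e r k S X)) = omega (bits e) := by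
  funext j
  by_cases hj : j = k
  · subst hj
    conv_rhs => rw [← h.eq]
    rw [h.omega_left hX, h.omega_left h.subset, hcard]
  · by_cases hj' : j = k + 1
    · subst hj'
      conv_rhs => rw [← h.eq]
      rw [h.omega_right, h.omega_right, card_sdiff_of_subset hX, card_sdiff_of_subset h.subset,
        hcard]
    · exact h.omega_of_ne X hj hj'

theorem div_eq (h : IsPlacement e r k S Y) (X : Finset (Fin n)) (i : Fin n) :
    place e r k S X i / 2 ^ (k + 2) = e i / 2 ^ (k + 2) := by
  refine Nat.eq_of_testBit_eq fun j => ?_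
  rw [Nat.testBit_div_two_pow, Nat.testBit_div_two_pow]
  exact h.testBit_of_ne X i (by omega) (by omega)

end IsPlacement

/-- Adding 2^k to a row with digits 1, 0 in columns k, k + 1 turns them into 0, 1 and affects no
other column. -/
theorem place_add (e r : Fin n → ℕ) (k : ℕ) {S X E : Finset (Fin n)} (hXE : X ⊆ E)
    (hE : E ⊆ S) :
    place e r k S E + (fun i => if i ∈ E \ X then 2 ^ k else 0) = place e r k S X := by
  funext i
  simp only [Pi.add_apply, place, mem_sdiff]
  by_cases hX : i ∈ X
  · simp [hX, hXE hX, hE (hXE hX)]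
  · by_cases hiE : i ∈ E
    · simp [hX, hiE, hE hiE]
    · simp [hX, hiE]

theorem sum_place (e r : Fin n → ℕ) (k : ℕ) {S X : Finset (Fin n)} (hX : X ⊆ S) :
    ∑ i, place e r k S X i + 2 ^ k * #X = ∑ i, place e r k S ∅ i := by
  rw [← place_add e r k (empty_subset X) hX]
  simp [sum_add_distrib, mul_comm]

section Exchange

variable {d k : ℕ} {ws : ℕ → ℕ} {e r : Fin n → ℕ} {S Y : Finset (Fin n)}

/-- The polynomials of degree `d` that are negligible when `mono e` is straightened. -/
noncomputable def negligible (d : ℕ) (e : Fin n → ℕ) : Submodule (ZMod 2) (P n) :=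
  hitsIn n d ⊔ monoSpan d (Higher e)

/-- Sq^K with K = 2^k (#E - #Y) is applied to the monomial with digits 1, 0 exactly in the rows E of
S. Adding 2^k in #E - #Y of these rows yields the displayed sum. Any other term lowers a column
before k, hence is hit, or carries beyond column k + 1, hence is `Higher`. -/
theorem sum_place_mem_negligible (h : IsPlacement e r k S Y) (hws : Antitone ws)
    (huniq : ∀ w, IsDescendingOmega n d w → w = ws) (hd : ∑ i, e i = d)
    (hk : ∀ j < k, omega (bits e) j = ws j) {E : Finset (Fin n)} (hE : E ⊆ S) (hlt : #Y < #E) :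
    ∑ X ∈ powersetCard #Y E, mono (place e r k S X) ∈ negligible d e := by
  classical
  set K := 2 ^ k * (#E - #Y) with hK
  have hpos : 0 < 2 ^ k := by positivity
  have hdeg : ∑ i, place e r k S E i + K = d := by
    have h1 := sum_place e r k hE
    have h2 := sum_place e r k h.subset
    rw [h.eq, hd] at h2
    rw [hK, Nat.mul_sub]
    have := Nat.mul_le_mul_left (2 ^ k) hlt.le
    omega
  set φ : Finset (Fin n) → (Fin n → ℕ) := fun X i => if i ∈ E \ X then 2 ^ k else 0 with hφ
  have hφmem : ∀ X ∈ powersetCard #Y E, φ X ∈ sqTerms (place e r k S E) K := by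
    intro X hX
    obtain ⟨hXE, hc⟩ := mem_powersetCard.1 hX
    refine mem_sqTerms.2 ⟨?_, fun i j hj => ?_⟩
    · rw [← sum_filter, filter_mem_eq_inter, univ_inter, sum_const, card_sdiff_of_subset hXE, hc,
        hK, smul_eq_mul, mul_comm]
    · by_cases hi : i ∈ E \ X
      · simp only [hφ, hi, if_true, Nat.testBit_two_pow, decide_eq_true_eq] at hj
        subst hj
        rw [h.testBit_left (hE (mem_sdiff.1 hi).1)]
        simp [(mem_sdiff.1 hi).1]
      · simp only [hφ, hi, if_false, Nat.zero_testBit, Bool.false_eq_true] at hj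
  have hinj : Set.InjOn φ (powersetCard #Y E : Set (Finset (Fin n))) := by
    intro X hX X' hX' heq
    have hXE := (mem_powersetCard.1 (mem_coe.1 hX)).1
    have hXE' := (mem_powersetCard.1 (mem_coe.1 hX')).1
    have hsd : E \ X = E \ X' := by
      ext i
      have := congrFun heq i
      simp only [hφ] at this
      by_cases h1 : i ∈ E \ X <;> by_cases h2 : i ∈ E \ X' <;> simp only [h1, h2, if_true,
        if_false] at this ⊢ <;> omega
    rw [← Finset.sdiff_sdiff_eq_self hXE, ← Finset.sdiff_sdiff_eq_self hXE', hsd]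
  have hsq : Sq n K (mono (place e r k S E)) ∈ hitsIn n d :=
    Sq_mono_mem_hitsIn (Nat.mul_pos hpos (by omega)) hdeg
  have himg : (powersetCard #Y E).image φ ⊆ sqTerms (place e r k S E) K :=
    image_subset_iff.2 hφmem
  rw [Sq_mono, ← sum_sdiff himg, sum_image hinj] at hsq
  have hgood : ∑ X ∈ powersetCard #Y E, mono (place e r k S E + φ X) =
      ∑ X ∈ powersetCard #Y E, mono (place e r k S X) :=
    sum_congr rfl fun X hX => by
      rw [hφ, place_add e r k (mem_powersetCard.1 hX).1 hE]
  rw [hgood] at hsq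
  refine (Submodule.add_mem_iff_right _ ?_).1 (Submodule.mem_sup_left hsq)
  refine Submodule.sum_mem _ fun t ht => ?_
  obtain ⟨htm, htn⟩ := mem_sdiff.1 ht
  obtain ⟨hsum, hsub⟩ := mem_sqTerms.1 htm
  have hdt : ∑ i, (place e r k S E + t) i = d := by
    rw [← hdeg, ← hsum, ← sum_add_distrib]; rfl
  by_cases hdvd : ∀ i, 2 ^ k ∣ t i
  · refine Submodule.mem_sup_right (mono_mem_monoSpan hdt (Or.inl ?_))
    refine colex_omega_lt_of_div (k := k + 2) (fun i => ?_) ?_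
    · rw [← h.div_eq E i]
      exact Nat.div_le_div_right (Nat.le_add_right _ _)
    · by_contra hno
      push Not at hno
      -- Without a carry beyond column k + 1, only rows with digits 1, 0 can change; rows outside S
      -- have equal digits there.
      have hrow : ∀ i, t i ≠ 0 → t i = 2 ^ k ∧ i ∈ E := by
        intro i hi
        have hle := hno i
        rw [← h.div_eq E i] at hle
        obtain ⟨h1, h2, h3⟩ := eq_two_pow_of_div_le (hsub i) (hdvd i) hi hle
        refine ⟨h1, ?_⟩
        by_cases hiS : i ∈ S
        · rw [h.testBit_left hiS] at h2
          simpa using h2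
        · have := h.bit_eq i hiS
          simp only [place, hiS, if_false] at h2 h3
          rw [h2, h3] at this
          simp at this
      refine htn (mem_image.2 ⟨E.filter fun i => t i = 0, mem_powersetCard.2
        ⟨filter_subset _ _, ?_⟩, funext fun i => ?_⟩)
      · have h1 : ∑ i, t i = 2 ^ k * #(E.filter fun i => ¬ t i = 0) := by
          rw [card_eq_sum_ones, mul_sum, sum_filter]
          rw [← sum_subset (subset_univ E)
            (fun i _ hi => by by_contra h0; exact hi (hrow i h0).2)]
          refine sum_congr rfl fun i _ => ?_
          by_cases h0 : t i = 0
          · simp [h0]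
          · simp [(hrow i h0).1]
        rw [hsum, hK] at h1
        have h2 := Nat.eq_of_mul_eq_mul_left hpos h1
        have h3 := card_filter_add_card_filter_not (s := E) (fun i => t i = 0)
        omega
      · by_cases h0 : t i = 0
        · simp [hφ, h0]
        · simp [hφ, (hrow i h0).1, (hrow i h0).2]
  · push Not at hdvd
    refine Submodule.mem_sup_left (mono_mem_hitsIn_of_lex_lt hws huniq _ hdt ?_)
    obtain ⟨c, hc, hceq, hclt⟩ := lowerBefore_add (k := k) 0 hsub hdvd
    have hom : ∀ j < k, omega (bits (place e r k S E)) j = ws j := fun j hj => by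
      rw [h.omega_of_ne E (by omega) (by omega), hk j hj]
    have hfun : (fun i => place e r k S E i + t i + 2 ^ k * (0 : Fin n → ℕ) i) =
        place e r k S E + t := by
      funext i; simp
    rw [hfun] at hceq hclt
    exact ⟨c, fun j hj => (hceq j hj).trans (hom j (lt_trans hj hc)), hclt.trans_eq (hom c hc)⟩

/-- Inclusion-exclusion modulo 2: X' occurs once for each subset of X \ X', hence an even number of
times unless X ⊆ X'. -/
theorem sum_powersetCard_sdiff {M : Type*} [AddCommGroup M] [Module (ZMod 2) M]
    (X E : Finset (Fin n)) (p : ℕ) (f : Finset (Fin n) → M) :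
    ∑ Z ∈ X.powerset, ∑ X' ∈ powersetCard p (E \ Z), f X' =
      ∑ X' ∈ (powersetCard p E).filter (fun X' => X ⊆ X'), f X' := by
  classical
  have h1 : ∀ Z ∈ X.powerset, ∑ X' ∈ powersetCard p (E \ Z), f X' =
      ∑ X' ∈ powersetCard p E, if Disjoint X' Z then f X' else 0 := by
    intro Z _
    rw [← sum_filter]
    refine sum_congr ?_ fun _ _ => rfl
    ext X'
    simp only [mem_powersetCard, mem_filter, subset_sdiff]
    tauto
  rw [sum_congr rfl h1, sum_comm, sum_filter]
  refine sum_congr rfl fun X' _ => ?_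
  have h2 : X.powerset.filter (fun Z => Disjoint X' Z) = (X \ X').powerset := by
    ext Z
    simp only [mem_filter, mem_powerset, subset_sdiff, disjoint_comm]
  rw [← sum_filter, h2, sum_const, card_powerset]
  split_ifs with hsub
  · simp [sdiff_eq_empty_iff_subset.2 hsub]
  · have hpos : #(X \ X') ≠ 0 := by
      rw [card_ne_zero, sdiff_nonempty]
      exact hsub
    obtain ⟨m, hm⟩ := Nat.exists_eq_succ_of_ne_zero hpos
    rw [hm, pow_succ, mul_nsmul, ← Nat.cast_smul_eq_nsmul (ZMod 2) 2]
    rw [show ((2 : ℕ) : ZMod 2) = 0 from rfl, zero_smul]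

/-- A Garnir-type relation. Y holds the rows with digits 1, 0, and X ⊆ Y and B the rows before ρ
with digits 1, 0 and 0, 1. As #B > #X, every (Y ∪ B) \ Z with Z ⊆ X has more than #Y rows and gives
a negligible sum. Adding these keeps only placements containing X: `mono e` itself and monomials
larger in the order `Higher`. -/
theorem mono_mem_negligible (hws : Antitone ws)
    (huniq : ∀ w, IsDescendingOmega n d w → w = ws) (hd : ∑ i, e i = d)
    (hk : ∀ j < k, omega (bits e) j = ws j) {ρ : ℕ}
    (hρ : #((column (bits e) k).filter fun i : Fin n => (i : ℕ) < ρ) <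
      #((column (bits e) (k + 1)).filter fun i : Fin n => (i : ℕ) < ρ)) :
    mono e ∈ negligible d e := by
  classical
  obtain ⟨r, h⟩ := exists_isPlacement e k
  set C₁ := column (bits e) k
  set C₂ := column (bits e) (k + 1)
  set Y := C₁ \ C₂ with hY
  set B := (C₂ \ C₁).filter fun i : Fin n => (i : ℕ) < ρ with hB
  set X := Y.filter fun i : Fin n => (i : ℕ) < ρ with hX
  set S := Y ∪ C₂ \ C₁ with hS
  have hXB : #X < #B := by
    have h1 := card_sdiff_add_card_inter (C₁.filter fun i : Fin n => (i : ℕ) < ρ)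
      (C₂.filter fun i : Fin n => (i : ℕ) < ρ)
    have h2 := card_sdiff_add_card_inter (C₂.filter fun i : Fin n => (i : ℕ) < ρ)
      (C₁.filter fun i : Fin n => (i : ℕ) < ρ)
    have h3 : (C₁.filter fun i : Fin n => (i : ℕ) < ρ) \ (C₂.filter fun i : Fin n => (i : ℕ) < ρ)
        = X := by
      ext i; simp only [hX, hY, mem_sdiff, mem_filter]; tauto
    have h4 : (C₂.filter fun i : Fin n => (i : ℕ) < ρ) \ (C₁.filter fun i : Fin n => (i : ℕ) < ρ)
        = B := by
      ext i; simp only [hB, mem_sdiff, mem_filter]; tauto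
    rw [h3] at h1
    rw [h4, inter_comm] at h2
    omega
  have hYB : Disjoint Y B :=
    disjoint_left.2 fun i hi hi' => by
      simp only [hY, hB, mem_sdiff, mem_filter] at hi hi'
      tauto
  have hES : Y ∪ B ⊆ S := union_subset_union_right (filter_subset _ _)
  have hXY : X ⊆ Y := filter_subset _ _
  have hmem : ∑ Z ∈ X.powerset, ∑ X' ∈ powersetCard #Y ((Y ∪ B) \ Z), mono (place e r k S X') ∈
      negligible d e := by
    refine Submodule.sum_mem _ fun Z hZ => ?_
    rw [mem_powerset] at hZ
    refine sum_place_mem_negligible h hws huniq hd hk (sdiff_subset.trans hES) ?_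
    rw [card_sdiff_of_subset (hZ.trans (hXY.trans subset_union_left)),
      card_union_of_disjoint hYB]
    have := card_le_card hZ
    omega
  rw [sum_powersetCard_sdiff] at hmem
  have hYm : Y ∈ (powersetCard #Y (Y ∪ B)).filter (fun X' => X ⊆ X') :=
    mem_filter.2 ⟨mem_powersetCard.2 ⟨subset_union_left, rfl⟩, hXY⟩
  rw [← add_sum_erase _ _ hYm, h.eq] at hmem
  refine (Submodule.add_mem_iff_left _ ?_).1 hmem
  refine Submodule.sum_mem _ fun X' hX' => Submodule.mem_sup_right ?_
  obtain ⟨hne, hX'⟩ := mem_erase.1 hX'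
  obtain ⟨hX', hXX'⟩ := mem_filter.1 hX'
  obtain ⟨hsub, hcard⟩ := mem_powersetCard.1 hX'
  have hXS := hsub.trans hES
  refine mono_mem_monoSpan ?_ (Or.inr ⟨(h.omega_eq hXS hcard).symm, ?_⟩)
  · have h1 := sum_place e r k hXS
    have h2 := sum_place e r k h.subset
    rw [h.eq, hd] at h2
    rw [hcard] at h1
    omega
  -- The last row i of Y missing from X' is not before ρ, because X ⊆ X'. There the exponent grows
  -- by 2^k; later rows agree, since all of B lies before ρ.
  · have hnon : (Y \ X').Nonempty := by
      rw [sdiff_nonempty]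
      exact fun hYX => hne (eq_of_subset_of_card_le hYX hcard.le).symm
    set i := (Y \ X').max' hnon
    obtain ⟨hiY, hiX'⟩ := mem_sdiff.1 ((Y \ X').max'_mem hnon)
    have hiρ : ρ ≤ (i : ℕ) := by
      by_contra hc
      exact hiX' (hXX' (mem_filter.2 ⟨hiY, not_le.1 hc⟩))
    refine ⟨i, fun j (hj : i < j) => ?_, ?_⟩
    · have hiff : j ∈ X' ↔ j ∈ Y := by
        constructor
        · intro hjX
          rcases mem_union.1 (hsub hjX) with hjY | hjB
          · exact hjY
          · have h1 := (mem_filter.1 hjB).2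
            have h2 : (i : ℕ) < j := hj
            omega
        · intro hjY
          by_contra hjX
          exact ((Y \ X').le_max' j (mem_sdiff.2 ⟨hjY, hjX⟩)).not_gt hj
      have := congrFun h.eq j
      simp only [Pi.toColex_apply]
      rw [← this]
      simp only [place, hiff]
    · have := congrFun h.eq i
      have hiS : i ∈ S := h.subset hiY
      simp only [Pi.toColex_apply]
      conv_lhs => rw [← this]
      simp only [place, hiS, show i ∈ Y from hiY, show i ∉ X' from hiX', if_true, if_false]
      have : 0 < 2 ^ k := by positivity
      omega

end Exchange

/-! ### Semistandard blocks span the cohits -/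

theorem omega_firstRows (F : BinArray n) {r : ℕ} (hr : r ≤ n) (j : ℕ) :
    omega (firstRows F r hr) j = #((column F j).filter fun i : Fin n => (i : ℕ) < r) := by
  rw [omega, ← card_map (Fin.castLEEmb hr)]
  congr 1
  ext i
  rw [mem_map, mem_filter]
  constructor
  · rintro ⟨a, ha, rfl⟩
    exact ⟨mem_column.2 (mem_column.1 ha :), a.2⟩
  · rintro ⟨h1, h2⟩
    exact ⟨⟨i, h2⟩, mem_column.2 (mem_column.1 h1 :), rfl⟩

theorem filter_val_lt_eq_self {r : ℕ} (hr : n ≤ r) (C : Finset (Fin n)) :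
    (C.filter fun i : Fin n => (i : ℕ) < r) = C :=
  filter_true_of_mem fun i _ => i.2.trans_le hr

theorem isSemistandard_iff (F : BinArray n) :
    IsSemistandard F ↔ ∀ r j, #((column F (j + 1)).filter fun i : Fin n => (i : ℕ) < r) ≤
      #((column F j).filter fun i : Fin n => (i : ℕ) < r) := by
  constructor
  · intro h r j
    have key : ∀ r ≤ n, #((column F (j + 1)).filter fun i : Fin n => (i : ℕ) < r) ≤
        #((column F j).filter fun i : Fin n => (i : ℕ) < r) := by
      intro r hr
      rcases Nat.eq_zero_or_pos r with rfl | hpos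
      · simp
      · have := h r hr hpos (Nat.le_succ j)
        rwa [omega_firstRows, omega_firstRows] at this
    rcases le_total r n with hr | hr
    · exact key r hr
    · have := key n le_rfl
      rw [filter_val_lt_eq_self le_rfl, filter_val_lt_eq_self le_rfl] at this
      rwa [filter_val_lt_eq_self hr, filter_val_lt_eq_self hr]
  · intro h r hr _
    refine antitone_nat_of_succ_le fun j => ?_
    rw [omega_firstRows, omega_firstRows]
    exact h r j

theorem IsSemistandard.antitone_omega {F : BinArray n} (h : IsSemistandard F) :
    Antitone (omega F) := by
  refine antitone_nat_of_succ_le fun j => ?_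
  have := (isSemistandard_iff F).1 h n j
  rwa [filter_val_lt_eq_self le_rfl, filter_val_lt_eq_self le_rfl] at this

theorem mono_mem_sup_semistandard {d : ℕ} {ws : ℕ → ℕ} (hws : IsDescendingOmega n d ws)
    (huniq : ∀ w, IsDescendingOmega n d w → w = ws) (e : Fin n → ℕ) (hd : ∑ i, e i = d) :
    mono e ∈ hitsIn n d ⊔ monoSpan d fun e => IsSemistandard (bits e) := by
  let r : {e : Fin n → ℕ // ∑ i, e i = d} → {e : Fin n → ℕ // ∑ i, e i = d} → Prop :=
    fun a b => Higher b.1 a.1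
  have : IsTrans _ r := ⟨fun _ _ _ h h' => h'.trans h⟩
  have : Std.Irrefl r := ⟨fun a => Higher.irrefl a.1⟩
  have hwf : WellFounded r := Finite.wellFounded_of_trans_of_irrefl r
  suffices H : ∀ a : {e : Fin n → ℕ // ∑ i, e i = d},
      mono a.1 ∈ hitsIn n d ⊔ monoSpan d fun e => IsSemistandard (bits e) from H ⟨e, hd⟩
  intro a
  induction a using hwf.induction with
  | _ a ih =>
    obtain ⟨e, hd⟩ := a
    have hneg : mono e ∈ negligible d e →
        mono e ∈ hitsIn n d ⊔ monoSpan d fun e => IsSemistandard (bits e) := fun h =>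
      (sup_le le_sup_left (monoSpan_le fun e' hd' hlt => ih ⟨e', hd'⟩ hlt)) h
    rcases lt_trichotomy (toLex (omega (bits e))) (toLex ws) with hlt | heq | hgt
    · exact Submodule.mem_sup_left (mono_mem_hitsIn_of_lex_lt hws.1 huniq e hd hlt)
    · have heq' : omega (bits e) = ws := heq
      by_cases hss : IsSemistandard (bits e)
      · exact Submodule.mem_sup_right (mono_mem_monoSpan hd hss)
      · rw [isSemistandard_iff] at hss
        push Not at hss
        obtain ⟨ρ, k, hρ⟩ := hss
        exact hneg (mono_mem_negligible hws.1 huniq hd (fun j _ => congrFun heq' j) hρ)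
    · obtain ⟨k, hk, hkk⟩ := hgt
      obtain ⟨l, rfl, hl⟩ := exists_lt_of_gt_descending hws huniq hd
        (fun j hj => (hk j hj).symm) hkk
      -- With ρ = n the ascent is between the full column sums.
      refine hneg (mono_mem_negligible (k := l) (ρ := n) hws.1 huniq hd
        (fun j hj => (hk j (lt_trans hj (Nat.lt_succ_self l))).symm) ?_)
      rwa [filter_val_lt_eq_self le_rfl, filter_val_lt_eq_self le_rfl]

theorem homog_le_sup_semistandard {d : ℕ} {ws : ℕ → ℕ} (hws : IsDescendingOmega n d ws)
    (huniq : ∀ w, IsDescendingOmega n d w → w = ws) :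
    homog n d ≤ hits n ⊔ monoSpan d fun e => IsSemistandard (bits e) := by
  intro f hf
  rw [f.as_sum]
  refine Submodule.sum_mem _ fun m hm => ?_
  have hdeg : ∑ i, m i = d := by
    rw [← Finsupp.degree_eq_sum, Finsupp.degree_eq_weight_one]
    exact hf (MvPolynomial.mem_support_iff.1 hm)
  rw [← mul_one (f.coeff m), ← smul_eq_mul, ← MvPolynomial.smul_monomial, monomial_eq_mono]
  exact Submodule.smul_mem _ _ (sup_le_sup_right (hitsIn_le_hits d) _
    (mono_mem_sup_semistandard hws huniq m hdeg))

theorem span_semistandard_eq_top {d : ℕ} {ws : ℕ → ℕ} (hws : IsDescendingOmega n d ws)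
    (huniq : ∀ w, IsDescendingOmega n d w → w = ws) :
    Submodule.span (ZMod 2) {q : Cohits n d | ∃ (e : Fin n →₀ ℕ) (he : e.degree = d),
      IsSemistandard (block e) ∧ q = monomialClass e he} = ⊤ := by
  rw [eq_top_iff]
  rintro q -
  obtain ⟨⟨f, hf⟩, rfl⟩ := Submodule.Quotient.mk_surjective _ q
  have hclass : ∀ g ∈ monoSpan d (fun e : Fin n → ℕ => IsSemistandard (bits e)),
      ∃ hg : g ∈ homog n d, (Submodule.Quotient.mk ⟨g, hg⟩ : Cohits n d) ∈
        Submodule.span (ZMod 2) {q : Cohits n d | ∃ (e : Fin n →₀ ℕ) (he : e.degree = d),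
          IsSemistandard (block e) ∧ q = monomialClass e he} := by
    intro g hg
    induction hg using Submodule.span_induction with
    | zero => exact ⟨Submodule.zero_mem _, Submodule.zero_mem _⟩
    | add x y _ _ hx hy =>
      obtain ⟨hx1, hx2⟩ := hx
      obtain ⟨hy1, hy2⟩ := hy
      exact ⟨Submodule.add_mem _ hx1 hy1, Submodule.add_mem _ hx2 hy2⟩
    | smul c x _ hx =>
      obtain ⟨hx1, hx2⟩ := hx
      exact ⟨Submodule.smul_mem _ c hx1, Submodule.smul_mem _ c hx2⟩
    | mem x hx =>
      obtain ⟨e, hd, hss, rfl⟩ := hx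
      set e' : Fin n →₀ ℕ := Finsupp.equivFunOnFinite.symm e with he'
      have hcoe : ⇑e' = e := rfl
      have hdeg : e'.degree = d := by rw [Finsupp.degree_eq_sum, hcoe, hd]
      have hmono : MvPolynomial.monomial e' (1 : ZMod 2) = mono e := monomial_eq_mono e'
      refine ⟨hmono ▸ MvPolynomial.isHomogeneous_monomial 1 hdeg, Submodule.subset_span
        ⟨e', hdeg, hss, ?_⟩⟩
      simp only [monomialClass, hmono]
  obtain ⟨h, hh, g, hg, rfl⟩ := Submodule.mem_sup.1 (homog_le_sup_semistandard hws huniq hf)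
  obtain ⟨hgh, hmem⟩ := hclass g hg
  convert hmem using 1
  rw [Submodule.Quotient.eq, Submodule.submoduleOf, Submodule.mem_comap]
  simpa using hh

/-! ### Column-position arrays -/

/-- In `cp` the coercion to ℕ acts on the whole list through `bind` and `pure`; here it is brought
inside the `map`. -/
theorem cp_eq_getD_map (F : BinArray n) (i j : ℕ) :
    cp F i j = (((column F j).sort (· ≤ ·)).map fun r : Fin n => (r : ℕ) + 1).getD i 0 := by
  rw [cp]
  congr 1
  simp only [List.bind_eq_flatMap, List.pure_def, ← List.map_eq_flatMap, List.map_map]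
  rfl

theorem cp_of_lt {F : BinArray n} {i j : ℕ} (h : i < #(column F j)) :
    cp F i j = ((column F j).orderEmbOfFin rfl ⟨i, h⟩ : ℕ) + 1 := by
  have hl : i < (((column F j).sort (· ≤ ·)).map fun r : Fin n => (r : ℕ) + 1).length := by
    simpa using h
  rw [cp_eq_getD_map, List.getD_eq_getElem _ _ hl, List.getElem_map, orderEmbOfFin_apply]
  rfl

theorem cp_of_le {F : BinArray n} {i j : ℕ} (h : #(column F j) ≤ i) : cp F i j = 0 := by
  rw [cp_eq_getD_map, List.getD_eq_default]
  simpa using h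

/-- Entries increase down a column, so entry i is at most r iff entries 0, …, i all come from the
first r rows. The strict inequality reflects that i counts from 0 while positions count from 1. -/
theorem cp_le_iff {F : BinArray n} {i j : ℕ} (h : i < #(column F j)) (r : ℕ) :
    cp F i j ≤ r ↔ i < #((column F j).filter fun a : Fin n => (a : ℕ) < r) := by
  rw [cp_of_lt h, Nat.succ_le_iff]
  set f := (column F j).orderEmbOfFin rfl
  constructor
  · intro hlt
    have hsub : (univ.filter fun l : Fin #(column F j) => l ≤ ⟨i, h⟩).map f.toEmbedding ⊆
        (column F j).filter fun a : Fin n => (a : ℕ) < r := by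
      intro a ha
      obtain ⟨l, hl, rfl⟩ := mem_map.1 ha
      refine mem_filter.2 ⟨orderEmbOfFin_mem _ rfl l, ?_⟩
      exact lt_of_le_of_lt (f.monotone (mem_filter.1 hl).2) hlt
    have := card_le_card hsub
    rw [card_map, filter_ge_eq_Iic, Fin.card_Iic] at this
    exact this
  · intro hlt
    by_contra hge
    have hsub : (column F j).filter (fun a : Fin n => (a : ℕ) < r) ⊆
        (univ.filter fun l : Fin #(column F j) => l < ⟨i, h⟩).map f.toEmbedding := by
      intro a ha
      obtain ⟨ha1, ha2⟩ := mem_filter.1 ha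
      have : a ∈ Set.range f := by
        rw [range_orderEmbOfFin]; exact ha1
      obtain ⟨l, rfl⟩ := this
      refine mem_map.2 ⟨l, mem_filter.2 ⟨mem_univ _, ?_⟩, rfl⟩
      by_contra hl
      exact hge (lt_of_le_of_lt (f.monotone (not_lt.1 hl)) ha2)
    have := card_le_card hsub
    rw [card_map, filter_gt_eq_Iio, Fin.card_Iio] at this
    simp only at this
    omega

theorem mem_column_iff_cp {F : BinArray n} {j : ℕ} {a : Fin n} :
    a ∈ column F j ↔ ∃ i, cp F i j = (a : ℕ) + 1 := by
  constructor
  · intro ha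
    have : a ∈ Set.range ((column F j).orderEmbOfFin rfl) := by
      rw [range_orderEmbOfFin]; exact ha
    obtain ⟨l, rfl⟩ := this
    exact ⟨l, cp_of_lt l.2⟩
  · rintro ⟨i, hi⟩
    have hlt : i < #(column F j) := by
      by_contra hle
      rw [cp_of_le (not_lt.1 hle)] at hi
      omega
    rw [cp_of_lt hlt] at hi
    have : (column F j).orderEmbOfFin rfl ⟨i, hlt⟩ = a := Fin.ext (by omega)
    rw [← this]
    exact orderEmbOfFin_mem _ _ _

theorem block_injective : Function.Injective (block (n := n)) := by
  intro e e' h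
  ext i
  exact Nat.eq_of_testBit_eq fun j => congrFun (congrFun h i) j

theorem cp_block_injective : Function.Injective fun e : Fin n →₀ ℕ => cp (block e) := by
  intro e e' h
  refine block_injective (funext fun i => funext fun j => ?_)
  have hcol : i ∈ column (block e) j ↔ i ∈ column (block e') j := by
    rw [mem_column_iff_cp, mem_column_iff_cp]
    simp only at h
    rw [h]
  rw [Bool.eq_iff_iff]
  exact mem_column_bits.symm.trans (hcol.trans mem_column_bits)

/-! ### Semistandard blocks and tableaux -/

/-- The tableau of a semistandard block. -/
def tableauOfBlock {F : BinArray n} (hF : IsSemistandard F) {μ : YoungDiagram}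
    (hμ : omega F = μ.colLen) : SemistandardYoungTableau μ where
  entry := cp F
  row_weak' {i j₁ j₂} hj hmem := by
    rw [YoungDiagram.mem_iff_lt_colLen, ← hμ] at hmem
    have h1 : i < #(column F j₁) := lt_of_lt_of_le hmem (hF.antitone_omega hj.le)
    rw [cp_le_iff h1]
    have hanti : Antitone fun j => #((column F j).filter fun a : Fin n => (a : ℕ) < cp F i j₂) :=
      antitone_nat_of_succ_le fun j => (isSemistandard_iff F).1 hF _ j
    exact lt_of_lt_of_le ((cp_le_iff hmem _).1 le_rfl) (hanti hj.le)
  col_strict' {i₁ i₂ j} hi hmem := by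
    rw [YoungDiagram.mem_iff_lt_colLen, ← hμ] at hmem
    rw [cp_of_lt hmem, cp_of_lt (lt_trans hi hmem)]
    refine Nat.succ_lt_succ ?_
    exact ((column F j).orderEmbOfFin rfl).strictMono
      (show (⟨i₁, lt_trans hi hmem⟩ : Fin #(column F j)) < ⟨i₂, hmem⟩ from hi)
  zeros' {i j} hmem := by
    rw [YoungDiagram.mem_iff_lt_colLen, ← hμ] at hmem
    exact cp_of_le (not_lt.1 hmem)

theorem exists_bits_cp_eq {μ : YoungDiagram} (T : Tableaux n μ) :
    ∃ e : Fin n → ℕ, omega (bits e) = μ.colLen ∧ cp (bits e) = T.1 := by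
  have hpos : ∀ {i j}, i < μ.colLen j → 1 ≤ T.1 i j ∧ T.1 i j ≤ n := fun h =>
    T.2 _ _ (YoungDiagram.mem_iff_lt_colLen.2 h)
  let f : ∀ j, Fin (μ.colLen j) → Fin n := fun j i =>
    ⟨T.1 i j - 1, by have := hpos i.2; omega⟩
  have hf : ∀ j, StrictMono (f j) := by
    intro j i₁ i₂ hi
    have h1 := hpos i₁.2
    have h2 := T.1.col_strict (i1 := i₁) (i2 := i₂) (j := j) hi
      (YoungDiagram.mem_iff_lt_colLen.2 i₂.2)
    change T.1 i₁ j - 1 < T.1 i₂ j - 1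
    omega
  have hcard : ∀ j, #(univ.image (f j)) = μ.colLen j := fun j => by
    rw [card_image_of_injective _ (hf j).injective, card_univ, Fintype.card_fin]
  -- The digits of column j are the entries of column j of T, shifted to start from 0; columns from
  -- `μ.rowLen 0` on are empty.
  obtain ⟨e, he⟩ := exists_bits_column_eq (fun j => univ.image (f j)) (L := μ.rowLen 0)
    (fun j hj => by
      rw [← card_eq_zero, hcard]
      by_contra hne
      have h1 : (0, j) ∈ μ := YoungDiagram.mem_iff_lt_colLen.2 (Nat.pos_of_ne_zero hne)
      exact absurd (YoungDiagram.mem_iff_lt_rowLen.1 h1) (not_lt.2 hj))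
  have hc : ∀ j, #(column (bits e) j) = μ.colLen j := fun j => by rw [he, hcard]
  refine ⟨e, funext hc, funext fun i => funext fun j => ?_⟩
  by_cases hi : i < μ.colLen j
  · have hi' : i < #(column (bits e) j) := by rw [hc]; exact hi
    rw [cp_of_lt hi']
    have huniq := orderEmbOfFin_unique (s := column (bits e) j) (hc j) (f := f j)
      (fun x => by rw [he]; exact mem_image_of_mem _ (mem_univ x)) (hf j)
    have h1 : (column (bits e) j).orderEmbOfFin rfl ⟨i, hi'⟩ = f j ⟨i, hi⟩ := by
      rw [huniq, orderEmbOfFin_eq_orderEmbOfFin_iff]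
    rw [h1]
    have := hpos hi
    change T.1 i j - 1 + 1 = T.1 i j
    omega
  · rw [cp_of_le (by rw [hc]; exact not_lt.1 hi), T.1.zeros]
    rwa [YoungDiagram.mem_iff_lt_colLen]

/-- If column j has i digits in the first r rows and column j + 1 has more, then row i of the
tableau has an entry above r followed by one at most r. -/
theorem isSemistandard_of_cp_eq {F : BinArray n} {μ : YoungDiagram}
    {T : SemistandardYoungTableau μ} (hμ : omega F = μ.colLen) (hT : cp F = T) :
    IsSemistandard F := by
  rw [isSemistandard_iff]
  intro r j
  by_contra hlt
  rw [not_le] at hlt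
  set i := #((column F j).filter fun a : Fin n => (a : ℕ) < r)
  have h1 : i < #(column F (j + 1)) := hlt.trans_le (card_filter_le _ _)
  have hmem : (i, j + 1) ∈ μ := by
    rw [YoungDiagram.mem_iff_lt_colLen, ← hμ]; exact h1
  have hmem' : (i, j) ∈ μ := μ.up_left_mem le_rfl (Nat.le_succ j) hmem
  have h2 : i < #(column F j) := by
    rw [YoungDiagram.mem_iff_lt_colLen, ← hμ] at hmem'; exact hmem'
  have h3 := T.row_weak (Nat.lt_succ_self j) hmem
  rw [← hT] at h3
  exact lt_irrefl i ((cp_le_iff h2 r).1 (h3.trans ((cp_le_iff h1 r).2 hlt)))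

theorem exists_youngDiagram_colLen_eq {w : ℕ → ℕ} (hw : Antitone w) {L : ℕ}
    (hL : ∀ j, L ≤ j → w j = 0) : ∃ μ : YoungDiagram, μ.colLen = w := by
  let μ : YoungDiagram :=
    { cells := (range (w 0) ×ˢ range L).filter fun p => p.1 < w p.2
      isLowerSet := by
        rintro ⟨i, j⟩ ⟨i', j'⟩ ⟨hi, hj⟩ h
        simp only [coe_filter, mem_product, mem_range, Set.mem_ofPred_eq] at h hi hj ⊢
        have := hw hj
        omega }
  refine ⟨μ, funext fun j => eq_of_forall_lt_iff fun i => ?_⟩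
  rw [← YoungDiagram.mem_iff_lt_colLen]
  change (i, j) ∈ (range (w 0) ×ˢ range L).filter (fun p => p.1 < w p.2) ↔ _
  simp only [mem_filter, mem_product, mem_range]
  have h0 := hw (Nat.zero_le j)
  have := hL j
  constructor
  · exact fun h => h.2
  · intro h
    refine ⟨⟨by omega, ?_⟩, h⟩
    by_contra hc
    have := this (by omega)
    omega

theorem bijOn_cp {d : ℕ} {μ : YoungDiagram} (hμ : IsDescendingOmega n d μ.colLen)
    (huniq : ∀ w, IsDescendingOmega n d w → w = μ.colLen) :
    Set.BijOn (fun e : Fin n →₀ ℕ => cp (block e))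
      {e | e.degree = d ∧ IsSemistandard (block e)}
      {Y | ∃ T : Tableaux n μ, ∀ i j : ℕ, Y i j = T.1 i j} := by
  refine ⟨?_, cp_block_injective.injOn, ?_⟩
  · rintro e ⟨hd, hss⟩
    have hom : omega (block e) = μ.colLen := huniq _ ⟨hss.antitone_omega, e, hd, rfl⟩
    refine ⟨⟨tableauOfBlock hss hom, fun i j hij => ?_⟩, fun i j => rfl⟩
    rw [YoungDiagram.mem_iff_lt_colLen, ← hom] at hij
    change 1 ≤ cp (block e) i j ∧ cp (block e) i j ≤ n
    rw [cp_of_lt hij]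
    exact ⟨Nat.le_add_left 1 _, Fin.is_lt _⟩
  · rintro Y ⟨T, hT⟩
    obtain ⟨e, hom, hcp⟩ := exists_bits_cp_eq T
    obtain ⟨-, es, hds, hes⟩ := isDescendingOmega_iff.1 hμ
    -- The ω-vector determines the degree.
    have hd : ∑ i, e i = d := by
      obtain ⟨L, hL⟩ := exists_omega_eq_zero e
      rw [← hds, sum_eq_of_omega hL, sum_eq_of_omega (e := es) (L := L) (by rwa [hes, ← hom]),
        hom, hes]
    refine ⟨Finsupp.equivFunOnFinite.symm e, ⟨?_, isSemistandard_of_cp_eq hom hcp⟩, ?_⟩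
    · simpa [Finsupp.degree_eq_sum] using hd
    · exact hcp.trans (funext fun i => funext fun j => (hT i j).symm)

/-! ### Finiteness and the bound on the dimension -/

theorem finite_semistandard (n d : ℕ) :
    {e : Fin n →₀ ℕ | e.degree = d ∧ IsSemistandard (block e)}.Finite := by
  refine Set.Finite.of_finite_image (f := fun e : Fin n →₀ ℕ => (e : Fin n → ℕ)) ?_
    DFunLike.coe_injective.injOn
  refine Set.Finite.subset (s := {e : Fin n → ℕ | ∑ i, e i = d}) (finite_exponents n d) ?_
  rintro _ ⟨e, ⟨hd, -⟩, rfl⟩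
  rw [Finsupp.degree_eq_sum] at hd
  exact hd

/-- Tableaux are their entry functions. -/
noncomputable def tableauxEquiv (n : ℕ) (μ : YoungDiagram) :
    Tableaux n μ ≃ {Y : ℕ → ℕ → ℕ | ∃ T : Tableaux n μ, ∀ i j : ℕ, Y i j = T.1 i j} :=
  Equiv.ofBijective (fun T => ⟨T.1, T, fun _ _ => rfl⟩)
    ⟨fun _ _ h => Subtype.ext (DFunLike.coe_injective (congrArg Subtype.val h)),
      fun ⟨_, T, hT⟩ => ⟨T, Subtype.ext (funext fun i => funext fun j => (hT i j).symm)⟩⟩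

theorem rank_cohits_le {d : ℕ}
    (hspan : Submodule.span (ZMod 2) {q : Cohits n d | ∃ (e : Fin n →₀ ℕ) (he : e.degree = d),
      IsSemistandard (block e) ∧ q = monomialClass e he} = ⊤) :
    Module.rank (ZMod 2) (Cohits n d) ≤
      Cardinal.mk {e : Fin n →₀ ℕ | e.degree = d ∧ IsSemistandard (block e)} := by
  rw [← rank_top, ← hspan]
  refine (rank_span_le _).trans ?_
  refine (Cardinal.mk_le_mk_of_subset ?_).trans (Cardinal.mk_range_le (f := fun
    e : {e : Fin n →₀ ℕ | e.degree = d ∧ IsSemistandard (block e)} => monomialClass e.1 e.2.1))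
  rintro _ ⟨e, he, hss, rfl⟩
  exact ⟨⟨e, he, hss⟩, rfl⟩

end HitProblem

theorem theorem3p15 (n d : ℕ) :
    (HitProblem.IsRowRegular n d → ∃! w : ℕ → ℕ, HitProblem.IsDescendingOmega n d w) ∧
    ((∃! w : ℕ → ℕ, HitProblem.IsDescendingOmega n d w) →
      Submodule.span (ZMod 2)
          {q : HitProblem.Cohits n d | ∃ (e : Fin n →₀ ℕ) (he : e.degree = d),
            HitProblem.IsSemistandard (HitProblem.block e) ∧
              q = HitProblem.monomialClass e he} = ⊤ ∧
      ∃ μ : YoungDiagram, HitProblem.IsDescendingOmega n d μ.colLen ∧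
        Set.BijOn (fun e : Fin n →₀ ℕ => HitProblem.cp (HitProblem.block e))
          {e | e.degree = d ∧ HitProblem.IsSemistandard (HitProblem.block e)}
          {Y | ∃ T : HitProblem.Tableaux n μ, ∀ i j : ℕ, Y i j = T.1 i j} ∧
        Finite (HitProblem.Tableaux n μ) ∧
        Module.rank (ZMod 2) (HitProblem.Cohits n d) ≤
          (Nat.card (HitProblem.Tableaux n μ) : Cardinal)) := by
  refine ⟨HitProblem.existsUnique_isDescendingOmega_of_isRowRegular, ?_⟩
  rintro ⟨w, hw, huniq⟩
  have hspan := HitProblem.span_semistandard_eq_top hw huniq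
  obtain ⟨μ, rfl⟩ : ∃ μ : YoungDiagram, μ.colLen = w := by
    obtain ⟨hanti, e, -, rfl⟩ := hw
    obtain ⟨L, hL⟩ := HitProblem.exists_omega_eq_zero e
    exact HitProblem.exists_youngDiagram_colLen_eq hanti hL
  have hbij := HitProblem.bijOn_cp hw huniq
  have hequiv := (Set.BijOn.equiv _ hbij).trans (HitProblem.tableauxEquiv n μ).symm
  have hfin := (HitProblem.finite_semistandard n d).to_subtype
  have hfinT : Finite (HitProblem.Tableaux n μ) := Finite.of_equiv _ hequiv
  refine ⟨hspan, μ, hw, hbij, hfinT, (HitProblem.rank_cohits_le hspan).trans_eq ?_⟩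
  rw [Nat.cast_card, Cardinal.mk_congr hequiv]
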